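/- **Conventions.** Signs are elements of $\{\pm1\}$. For a bijection between intervals, $\operatorname{ori}=+1$ if it is increasing and $-1$ if it is decreasing. A *strip* is a set $S$ with $\mathbb R\times(u,v)\subset S\subset\mathbb R\times[u,v]$ for some real $u<v$, open in $\mathbb R\times[u,v]$; put $\partial_{-1}S=S\cap(\mathbb R\times\{u\})$ and $\partial_{+1}S=S\cap(\mathbb R\times\{v\})$. The *boundary intervals* of $S$ are the connected components of $\partial_{-1}S\cup\partial_{+1}S$. For boundary intervals $X,Y$, $X<Y$ means that they lie on the same side of the same strip and each point of $X$ is to the left of each point of $Y$. The *canonical foliation* of $S$ has as leaves the lines $\mathbb R\times\{t\}$, $u<t<v$, and the boundary intervals. A *striped atlas* on a two-dimensional topological manifold $Z$ (possibly with boundary, not necessarily connected) is a quotient map $q:\bigsqcup_{\lambda\in\Lambda}S_\lambda\to Z$ from a disjoint union of at most countably many strips, with two disjoint families $(X_\gamma)_{\gamma\in\Gamma}$, $(Y_\gamma)_{\gamma\in\Gamma}$ of mutually disjoint boundary intervals such that $q$ is injective off $\bigcup_\gamma(X_\gamma\cup Y_\gamma)$, $q(X_\gamma)=q(Y_\gamma)$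 for all $\gamma$, and the restrictions of $q$ to $X_\gamma$ and to $Y_\gamma$ are embeddings with closed images. Put $\phi_\gamma=(q|_{X_\gamma})^{-1}\circ q|_{Y_\gamma}:Y_\gamma\to X_\gamma$. The leaves of the canonical foliation of $Z$ are the $q$-images of the leaves of the strips. A homeomorphism is *foliated* if it maps each leaf onto a leaf. An *equivalence* of striped atlases $q:\bigsqcup_{\lambda\in\Lambda} S_\lambda\to Z$ and $q':\bigsqcup_{\lambda'\in\Lambda'} S'_{\lambda'}\to Z'$ is a pair of foliated homeomorphisms $h:\bigsqcup S_\lambda\to\bigsqcup S'_{\lambda'}$ and $k:Z\to Z'$ with $k\circ q=q'\circ h$. The *graph* $(\Lambda,H,\xi,\sigma)$ of $q$ consists of the vertex set $\Lambda$; the set $H$ of half-edges, i.e. all boundary intervals of the strips, divided into the linearly ordered sets $d_s(\lambda)$ of the boundary intervals contained in $\partial_sS_\lambda$ ($s=\pm1$); the involution $\xi:H\to H$ that interchanges $X_\gamma$ and $Y_\gamma$ for each $\gamma$ and fixes all other half-edges; and the orientations of gluing $\sigma(X_\gamma,Y_\gamma)=\sigma(Y_\gamma,X_\gamma)=\operatorname{ori}(\phi_\gamma)$.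 An *isomorphism* from $(\Lambda,H,\xi,\sigma)$ to $(\Lambda',H',\xi',\sigma')$ consists of bijections $\nu:\Lambda\to\Lambda'$, $\eta:H\to H'$ and maps $\varepsilon,\tau:\Lambda\to\{\pm1\}$ such that * for all $\lambda\in\Lambda$ and $s=\pm1$, $\eta(d_s(\lambda))=d'_{\tau(\lambda)s}(\nu(\lambda))$, and $\eta|_{d_s(\lambda)}$ is increasing if $\varepsilon(\lambda)=+1$ and decreasing if $\varepsilon(\lambda)=-1$; * $\xi'\circ\eta=\eta\circ\xi$; * if $X\in d_s(\lambda)$, $Y=\xi(X)\ne X$ and $Y\in d_{s'}(\mu)$, then $\varepsilon(\lambda)\,\sigma(X,Y)=\sigma'(\eta(X),\eta(Y))\,\varepsilon(\mu)$. An equivalence $(h,k)$ *induces* $(\nu,\eta,\varepsilon,\tau)$ if $h(S_\lambda)=S'_{\nu(\lambda)}$ for every $\lambda\in\Lambda$, $h(X)=\eta(X)$ for every $X\in H$, and, writing $h(x,y)=(\alpha_y(x),\beta(y))$ on the interior of $S_\lambda$, $\varepsilon(\lambda)=\operatorname{ori}(\alpha_y)$ for every $y$ and $\tau(\lambda)=\operatorname{ori}(\beta)$.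 **Theorem.** Let $q$ and $q'$ be striped atlases on two-dimensional manifolds $Z$ and $Z'$. Every equivalence $(h,k)$ of $q$ and $q'$ induces an isomorphism of their graphs, and only one. Conversely, every isomorphism $(\nu,\eta,\varepsilon,\tau)$ of their graphs is induced by some equivalence of $q$ and $q'$. -/

import Mathlib

open Set Topology

/-- A strip: a subset `S` of the plane with `ℝ × (u,v) ⊆ S ⊆ ℝ × [u,v]` for some `u < v`, open in
the topology of `ℝ × [u,v]`. -/
structure Strip where
  u : ℝ
  v : ℝ
  u_lt_v : u < v
  carrier : Set (ℝ × ℝ)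
  open_subset : univ ×ˢ Ioo u v ⊆ carrier
  subset_closed : carrier ⊆ univ ×ˢ Icc u v
  relatively_open : ∃ U : Set (ℝ × ℝ), IsOpen U ∧ carrier = U ∩ univ ×ˢ Icc u v

namespace Strip

/-- The height of the side `∂₋S` (`s = -1`) or `∂₊S` (`s = 1`). -/
def level (S : Strip) (s : ℤˣ) : ℝ := if s = 1 then S.v else S.u

/-- The side `∂ₛS` of a strip is `trace s × {level s}`. -/
def trace (S : Strip) (s : ℤˣ) : Set ℝ := {x | (x, S.level s) ∈ S.carrier}

theorem isOpen_trace (S : Strip) (s : ℤˣ) : IsOpen (S.trace s) := by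
  obtain ⟨U, hU, h⟩ := S.relatively_open
  have hl : S.level s ∈ Icc S.u S.v := by
    unfold level
    split_ifs
    · exact ⟨S.u_lt_v.le, le_rfl⟩
    · exact ⟨le_rfl, S.u_lt_v.le⟩
  have : S.trace s = (fun x : ℝ => (x, S.level s)) ⁻¹' U := by
    ext x
    simp only [trace, h, mem_ofPred_eq, mem_inter_iff, mem_prod, mem_univ, true_and, mem_preimage]
    exact ⟨fun hx => hx.1, fun hx => ⟨hx, hl⟩⟩
  rw [this]
  exact hU.preimage (by fun_prop)

end Strip

/-- The disjoint union `⨆ S_λ` of a family of strips, with the disjoint union topology. -/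
abbrev StripSum {Λ : Type*} (S : Λ → Strip) : Type _ := Σ l : Λ, (S l).carrier

namespace StripSum

variable {Λ : Type*} {S : Λ → Strip}

/-- The horizontal coordinate of a point of a strip. -/
def x (p : StripSum S) : ℝ := p.2.1.1

/-- The vertical coordinate of a point of a strip. -/
def y (p : StripSum S) : ℝ := p.2.1.2

/-- The point lies in the interior `ℝ × (u,v)` of its strip. -/
def IsInterior (p : StripSum S) : Prop := p.y ∈ Ioo (S p.1).u (S p.1).v

end StripSum

/-- A half-edge, that is, a boundary interval of one of the strips: a connected component
`interval × {level side}` of the boundary of the strip `S vertex`. -/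
@[ext]
structure HalfEdge {Λ : Type*} (S : Λ → Strip) where
  vertex : Λ
  side : ℤˣ
  interval : Set ℝ
  isComponent : ∃ a ∈ (S vertex).trace side,
    interval = connectedComponentIn ((S vertex).trace side) a

namespace HalfEdge

variable {Λ : Type*} {S : Λ → Strip}

/-- The boundary interval as a subset of the disjoint union of the strips. -/
def toSet (X : HalfEdge S) : Set (StripSum S) :=
  {p | p.1 = X.vertex ∧ p.x ∈ X.interval ∧ p.y = (S X.vertex).level X.side}

/-- The order of boundary intervals: `X < Y` if both lie on the same side of the same strip and
every point of `X` is to the left of every point of `Y`. -/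
def Lt (X Y : HalfEdge S) : Prop :=
  X.vertex = Y.vertex ∧ X.side = Y.side ∧ ∀ a ∈ X.interval, ∀ b ∈ Y.interval, a < b

theorem interval_nonempty (X : HalfEdge S) : X.interval.Nonempty := by
  obtain ⟨a, ha, h⟩ := X.isComponent
  exact ⟨a, h ▸ mem_connectedComponentIn ha⟩

theorem isOpen_interval (X : HalfEdge S) : IsOpen X.interval := by
  obtain ⟨a, _, h⟩ := X.isComponent
  rw [h]
  exact ((S X.vertex).isOpen_trace X.side).connectedComponentIn

theorem ordConnected_interval (X : HalfEdge S) : X.interval.OrdConnected := by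
  obtain ⟨a, _, h⟩ := X.isComponent
  rw [h]
  exact isPreconnected_connectedComponentIn.ordConnected

theorem eq_of_mem {X Y : HalfEdge S} (hv : X.vertex = Y.vertex) (hs : X.side = Y.side) {c : ℝ}
    (hX : c ∈ X.interval) (hY : c ∈ Y.interval) : X = Y := by
  obtain ⟨a, _, hXa⟩ := X.isComponent
  obtain ⟨b, _, hYb⟩ := Y.isComponent
  refine HalfEdge.ext hv hs ?_
  rw [hXa] at hX ⊢
  rw [hYb, ← hv, ← hs] at hY
  rw [hYb, ← hv, ← hs, connectedComponentIn_eq hX, connectedComponentIn_eq hY]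

theorem lt_irrefl (X : HalfEdge S) : ¬ X.Lt X := by
  obtain ⟨a, ha⟩ := X.interval_nonempty
  exact fun h => (h.2.2 a ha a ha).false

theorem lt_trans {X Y W : HalfEdge S} (h : X.Lt Y) (h' : Y.Lt W) : X.Lt W := by
  obtain ⟨b, hb⟩ := Y.interval_nonempty
  exact ⟨h.1.trans h'.1, h.2.1.trans h'.2.1,
    fun a ha c hc => (h.2.2 a ha b hb).trans (h'.2.2 b hb c hc)⟩

theorem lt_of_mem {X Y : HalfEdge S} (hv : X.vertex = Y.vertex) (hs : X.side = Y.side)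
    (hne : X ≠ Y) {a b : ℝ} (ha : a ∈ X.interval) (hb : b ∈ Y.interval) (hab : a < b) :
    X.Lt Y := by
  refine ⟨hv, hs, fun a' ha' b' hb' => ?_⟩
  by_contra! hle
  rcases le_or_gt b' a with h | h
  · exact hne (eq_of_mem hv hs ha (Y.ordConnected_interval.out hb' hb ⟨h, hab.le⟩))
  · exact hne (eq_of_mem hv hs (X.ordConnected_interval.out ha ha' ⟨h.le, hle⟩) hb')

theorem lt_total {X Y : HalfEdge S} (hv : X.vertex = Y.vertex) (hs : X.side = Y.side) :
    X.Lt Y ∨ X = Y ∨ Y.Lt X := by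
  by_cases hne : X = Y
  · exact Or.inr (Or.inl hne)
  obtain ⟨a, ha⟩ := X.interval_nonempty
  obtain ⟨b, hb⟩ := Y.interval_nonempty
  rcases lt_trichotomy a b with h | h | h
  · exact Or.inl (lt_of_mem hv hs hne ha hb h)
  · exact absurd (eq_of_mem hv hs ha (h ▸ hb)) hne
  · exact Or.inr (Or.inr (lt_of_mem hv.symm hs.symm (Ne.symm hne) hb ha h))

theorem countable_side (l : Λ) (s : ℤˣ) :
    {X : HalfEdge S | X.vertex = l ∧ X.side = s}.Countable := by
  have hr : ∀ X : HalfEdge S, ∃ r : ℚ, (r : ℝ) ∈ X.interval := fun X => by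
    obtain ⟨r, hr⟩ := Rat.isDenseEmbedding_coe_real.dense.exists_mem_open X.isOpen_interval
      X.interval_nonempty
    exact ⟨r, hr⟩
  choose r hr using hr
  refine MapsTo.countable_of_injOn (f := r) (t := univ) (mapsTo_univ _ _) ?_ (to_countable _)
  intro X hX Y hY h
  exact eq_of_mem (hX.1.trans hY.1.symm) (hX.2.trans hY.2.symm) (hr X) (h ▸ hr Y)

end HalfEdge

/-- The leaves of the canonical foliation of a disjoint union of strips: the interior horizontal
lines and the boundary intervals. -/
def stripLeaves {Λ : Type*} (S : Λ → Strip) : Set (Set (StripSum S)) :=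
  {ω | (∃ l : Λ, ∃ t ∈ Ioo (S l).u (S l).v, ω = {p | p.1 = l ∧ p.y = t}) ∨
    ∃ X : HalfEdge S, ω = X.toSet}

/-- A homeomorphism is foliated if it maps each leaf onto a leaf. -/
def IsFoliated {M N : Type*} [TopologicalSpace M] [TopologicalSpace N] (F : Set (Set M))
    (F' : Set (Set N)) (f : M ≃ₜ N) : Prop :=
  ∀ ω ∈ F, f '' ω ∈ F'

/-- A striped atlas `q : ⨆ S_λ → Z`, with its two families of glued boundary intervals. -/
structure StripedAtlas (Λ Γ Z : Type*) [TopologicalSpace Z] where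
  countable : Countable Λ
  S : Λ → Strip
  q : StripSum S → Z
  isQuotientMap : IsQuotientMap q
  X : Γ → HalfEdge S
  Y : Γ → HalfEdge S
  X_injective : Function.Injective X
  Y_injective : Function.Injective Y
  X_ne_Y : ∀ γ δ, X γ ≠ Y δ
  injOn : InjOn q (⋃ γ, (X γ).toSet ∪ (Y γ).toSet)ᶜ
  image_eq : ∀ γ, q '' (X γ).toSet = q '' (Y γ).toSet
  closedEmbedding_X : ∀ γ, IsClosedEmbedding ((X γ).toSet.domRestrict q)
  closedEmbedding_Y : ∀ γ, IsClosedEmbedding ((Y γ).toSet.domRestrict q)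

/-- The graph of the combinatorics of a striped atlas: vertices `Λ`, half-edges `H`, each incident
to a vertex and lying on a side, a linear order `lt` on each set `d l s`, an involution `ξ` and
an orientation of gluing `σ` on the half-edges that are not fixed by `ξ`. -/
structure StripedGraph (Λ H : Type*) where
  vertex : H → Λ
  side : H → ℤˣ
  countable_side : ∀ l s, {X | vertex X = l ∧ side X = s}.Countable
  lt : H → H → Prop
  lt_irrefl : ∀ X, ¬ lt X X
  lt_trans : ∀ X Y W, lt X Y → lt Y W → lt X W
  lt_same : ∀ X Y, lt X Y → vertex X = vertex Y ∧ side X = side Y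
  lt_total : ∀ X Y, vertex X = vertex Y → side X = side Y → lt X Y ∨ X = Y ∨ lt Y X
  ξ : H → H
  ξ_involutive : Function.Involutive ξ
  σ : {X : H // ξ X ≠ X} → ℤˣ
  σ_ξ : ∀ (X : H) (hX : ξ X ≠ X) (hX' : ξ (ξ X) ≠ ξ X), σ ⟨ξ X, hX'⟩ = σ ⟨X, hX⟩

/-- The set `d_s(l)` of half-edges incident to `l` on the side `s`. -/
def StripedGraph.d {Λ H : Type*} (G : StripedGraph Λ H) (l : Λ) (s : ℤˣ) : Set H :=
  {X | G.vertex X = l ∧ G.side X = s}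

/-- The relation `r` for `s = 1` and the opposite relation for `s = -1`. -/
def Signed {α : Type*} (s : ℤˣ) (r : α → α → Prop) (a b : α) : Prop :=
  (s = 1 ∧ r a b) ∨ (s = -1 ∧ r b a)

/-- An isomorphism of graphs: maps `ν` on vertices, `η` on half-edges, and sign functions `ε`
(direction along the strip) and `τ` (direction across the strip). -/
@[ext]
structure StripedGraph.Iso {Λ H Λ' H' : Type*} (G : StripedGraph Λ H) (G' : StripedGraph Λ' H')
    where
  ν : Λ ≃ Λ'
  η : H ≃ H'
  ε : Λ → ℤˣ
  τ : Λ → ℤˣ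
  image_d : ∀ l s, η '' G.d l s = G'.d (ν l) (τ l * s)
  monotone : ∀ l s, ∀ X ∈ G.d l s, ∀ Y ∈ G.d l s, G.lt X Y → Signed (ε l) G'.lt (η X) (η Y)
  comm : ∀ X, G'.ξ (η X) = η (G.ξ X)
  compat : ∀ (X : H) (hX : G.ξ X ≠ X) (hX' : G'.ξ (η X) ≠ η X),
    ε (G.vertex X) * G.σ ⟨X, hX⟩ = G'.σ ⟨η X, hX'⟩ * ε (G.vertex (G.ξ X))

namespace StripedAtlas

variable {Λ Γ Z : Type*} [TopologicalSpace Z] (A : StripedAtlas Λ Γ Z)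

/-- The leaves of the canonical foliation on `Z`: the images of the leaves of the strips. -/
def leaves : Set (Set Z) := (fun ω => A.q '' ω) '' stripLeaves A.S

/-- The gluing homeomorphism `φ_γ = (q|_{X_γ})⁻¹ ∘ q|_{Y_γ} : Y_γ → X_γ`. -/
noncomputable def glue (γ : Γ) : (A.Y γ).toSet ≃ₜ (A.X γ).toSet :=
  ((A.closedEmbedding_Y γ).isEmbedding.toHomeomorph.trans
    (Homeomorph.setCongr (by rw [range_domRestrict, range_domRestrict, A.image_eq γ]))).trans
    (A.closedEmbedding_X γ).isEmbedding.toHomeomorph.symm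

open scoped Classical in
/-- `ori f = 1` if the map `f` between boundary intervals preserves their orientation by the
horizontal coordinate, and `ori f = -1` otherwise. -/
noncomputable def ori {S : Λ → Strip} {I J : HalfEdge S} (f : I.toSet → J.toSet) : ℤˣ :=
  if ∀ p p' : I.toSet, p.1.x < p'.1.x → (f p).1.x < (f p').1.x then 1 else -1

open scoped Classical in
/-- The involution on half-edges: it interchanges `X_γ` and `Y_γ` and fixes the half-edges that
are not glued. -/
noncomputable def ξ (I : HalfEdge A.S) : HalfEdge A.S :=
  if h : ∃ γ, A.X γ = I then A.Y h.choose
  else if h : ∃ γ, A.Y γ = I then A.X h.choose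
  else I

theorem ξ_X (γ : Γ) : A.ξ (A.X γ) = A.Y γ := by
  have h : ∃ δ, A.X δ = A.X γ := ⟨γ, rfl⟩
  rw [ξ, dif_pos h, A.X_injective h.choose_spec]

theorem ξ_Y (γ : Γ) : A.ξ (A.Y γ) = A.X γ := by
  have h : ∃ δ, A.Y δ = A.Y γ := ⟨γ, rfl⟩
  rw [ξ, dif_neg (fun ⟨δ, hδ⟩ => A.X_ne_Y δ γ hδ), dif_pos h, A.Y_injective h.choose_spec]

theorem ξ_of_not {I : HalfEdge A.S} (hX : ∀ γ, A.X γ ≠ I) (hY : ∀ γ, A.Y γ ≠ I) : A.ξ I = I := by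
  rw [ξ, dif_neg (fun ⟨γ, h⟩ => hX γ h), dif_neg (fun ⟨γ, h⟩ => hY γ h)]

theorem ξ_involutive : Function.Involutive A.ξ := by
  intro I
  by_cases hX : ∃ γ, A.X γ = I
  · obtain ⟨γ, rfl⟩ := hX
    rw [ξ_X, ξ_Y]
  by_cases hY : ∃ γ, A.Y γ = I
  · obtain ⟨γ, rfl⟩ := hY
    rw [ξ_Y, ξ_X]
  · have h := A.ξ_of_not (fun γ h => hX ⟨γ, h⟩) (fun γ h => hY ⟨γ, h⟩)
    rw [h, h]

theorem exists_glued {I : HalfEdge A.S} (h : A.ξ I ≠ I) : ∃ γ, A.X γ = I ∨ A.Y γ = I := by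
  by_contra! hn
  exact h (A.ξ_of_not (fun γ => (hn γ).1) (fun γ => (hn γ).2))

/-- The orientation of gluing: `σ(X_γ, Y_γ) = ori φ_γ`. -/
noncomputable def σ (I : {I : HalfEdge A.S // A.ξ I ≠ I}) : ℤˣ :=
  ori (A.glue (A.exists_glued I.2).choose)

theorem σ_eq {I : HalfEdge A.S} (hI : A.ξ I ≠ I) {γ : Γ} (h : A.X γ = I ∨ A.Y γ = I) :
    A.σ ⟨I, hI⟩ = ori (A.glue γ) := by
  have key : (A.exists_glued hI).choose = γ := by
    rcases (A.exists_glued hI).choose_spec with h' | h' <;> rcases h with h | h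
    · exact A.X_injective (h'.trans h.symm)
    · exact absurd (h'.trans h.symm) (A.X_ne_Y _ _)
    · exact absurd (h.trans h'.symm) (A.X_ne_Y _ _)
    · exact A.Y_injective (h'.trans h.symm)
  unfold σ
  rw [key]

/-- The graph of a striped atlas. -/
noncomputable def graph : StripedGraph Λ (HalfEdge A.S) where
  vertex := HalfEdge.vertex
  side := HalfEdge.side
  countable_side := HalfEdge.countable_side
  lt := HalfEdge.Lt
  lt_irrefl := HalfEdge.lt_irrefl
  lt_trans := fun _ _ _ h h' => HalfEdge.lt_trans h h'
  lt_same := fun _ _ h => ⟨h.1, h.2.1⟩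
  lt_total := fun _ _ hv hs => HalfEdge.lt_total hv hs
  ξ := A.ξ
  ξ_involutive := A.ξ_involutive
  σ := A.σ
  σ_ξ := by
    intro I hI hI'
    obtain ⟨γ, h⟩ := A.exists_glued hI
    rw [A.σ_eq hI h, A.σ_eq hI' (γ := γ)]
    rcases h with rfl | rfl
    · exact Or.inr (A.ξ_X γ).symm
    · exact Or.inl (A.ξ_Y γ).symm

variable {Λ' Γ' Z' : Type*} [TopologicalSpace Z']

/-- An equivalence of striped atlases: foliated homeomorphisms `h` of the disjoint unions of
strips and `k` of the surfaces with `k ∘ q = q' ∘ h`. -/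
structure Equivalence (A : StripedAtlas Λ Γ Z) (A' : StripedAtlas Λ' Γ' Z') where
  h : StripSum A.S ≃ₜ StripSum A'.S
  k : Z ≃ₜ Z'
  h_foliated : IsFoliated (stripLeaves A.S) (stripLeaves A'.S) h
  k_foliated : IsFoliated A.leaves A'.leaves k
  comm : ∀ p, k (A.q p) = A'.q (h p)

/-- The equivalence `(h, k)` induces the isomorphism of graphs `f = (ν, η, ε, τ)`: `h` maps the
strip `S_l` onto `S'_{ν l}` and each boundary interval `X` onto `η X`, and on the interior of
`S_l`, where `h (x, y) = (α_y x, β y)`, the sign `ε l` is the orientation of every `α_y` and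
`τ l` is the orientation of `β`. -/
structure Equivalence.Induces {A : StripedAtlas Λ Γ Z} {A' : StripedAtlas Λ' Γ' Z'}
    (E : A.Equivalence A') (f : A.graph.Iso A'.graph) : Prop where
  vertex : ∀ l, E.h '' {p | p.1 = l} = {p | p.1 = f.ν l}
  halfEdge : ∀ X : HalfEdge A.S, E.h '' X.toSet = (f.η X).toSet
  horizontal : ∀ p p' : StripSum A.S, p.1 = p'.1 → p.IsInterior → p'.IsInterior →
    p.y = p'.y → p.x < p'.x → Signed (f.ε p.1) (· < ·) (E.h p).x (E.h p').x
  vertical : ∀ p p' : StripSum A.S, p.1 = p'.1 → p.IsInterior → p'.IsInterior →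
    p.y < p'.y → Signed (f.τ p.1) (· < ·) (E.h p).y (E.h p').y

end StripedAtlas

/-!
An equivalence of striped atlases determines an isomorphism of graphs because the whole of its
combinatorial data can be read off topologically. The strips are the connected components of the
disjoint union. An interior leaf disconnects its strip and a boundary interval does not
(`IsFoliated.isInterior`), so interior leaves and boundary intervals are permuted separately. The
signs are locally constant: a continuous function without zeros on the connected space of pairs of
points with increasing horizontal (or vertical) coordinate has constant sign
(`IsPreconnected.exists_sign`), and limits along vertical lines carry the horizontal sign over to
the boundary.

The gluing data need more. The definition of a striped atlas only asks `q` to be injective off the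
glued boundary intervals, so a priori a glued pair of points may be identified with further points.
That `Z` is a surface excludes this (`StripedAtlas.eq_or_exists_glued`): a disc about an interior
point, or two half-discs glued along their diameters, is embedded by `q` and covers a neighbourhood
by invariance of domain, which leaves no room for interior points near a further point of the
fibre. Invariance of domain in the plane (`image_unitDisc_mem_nhds`) follows from lifting through
the exponential covering and the fact that an odd loop has odd winding number.

Conversely, let an isomorphism of graphs be given. On the boundary intervals that are not some
`Y γ` one chooses arbitrary monotone bijections in the prescribed direction; on `Y γ` the gluing
maps then force the choice, and its direction is right by the compatibility with the orientations
of gluing (`StripedGraph.Iso.exists_boundary_maps`). The bijections on one side of a strip combine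
to a strictly monotone map `g` between open subsets of the line. There may be infinitely many
boundary intervals, in any countable order type, and `g` need not extend to the line. It extends,
however, after compressing the line to `(-1, 1)`, to a monotone function with jumps, and moving
averages of this function are homeomorphisms that converge to `g` pointwise
(`Monotone.exists_smoothing`, `exists_isotopy`). Used as horizontal maps on the leaves near the
side, they extend `g` over the strip; since all maps involved are monotone on leaves, pointwise
convergence suffices for continuity in both directions (`continuousOn_of_sections`,
`tendsto_of_sections`). The resulting homeomorphism of the strips descends to the surfaces because
the fibres of `q` and `q'` are known.
-/


/-! ### Invariance of domain in the plane -/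

/-- Two continuous logarithms of the same function differ by a constant. -/
theorem eq_of_exp_eq_const {E : Type*} [TopologicalSpace E] [PreconnectedSpace E] {k : E → ℂ}
    (hk : Continuous k) {w : ℂ} (h : ∀ x, Complex.exp (k x) = w) (x y : E) : k x = k y :=
  Complex.isCoveringMap_exp.const_of_comp hk
    (fun a b => Subtype.ext ((h a).trans (h b).symm)) x y

theorem exists_continuous_log {E : Type*} [NormedAddCommGroup E] [NormedSpace ℝ E] {g : E → ℂ}
    (hg : Continuous g) (h0 : ∀ x, g x ≠ 0) :
    ∃ L : E → ℂ, Continuous L ∧ ∀ x, Complex.exp (L x) = g x := by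
  obtain ⟨L, ⟨-, hL⟩, -⟩ := Complex.isCoveringMapOn_exp.existsUnique_continuousMap_lifts
    (⟨g, hg⟩ : C(E, ℂ)) (a₀ := 0) (Complex.exp_log (h0 0)) h0
  exact ⟨L, L.continuous, fun x => congrFun hL x⟩

/-- The image of a disc under a continuous injection is a neighbourhood of the image of the
centre. The loop `z ↦ f z - f 0` on the unit circle deforms without zeros to the odd loop
`z ↦ f (z / 2) - f (-z / 2)`, so it has no continuous logarithm along the circle. If `f` omitted
a point `c` close to `f 0`, then a logarithm of `f - c` on the disc would yield one. -/
theorem image_unitDisc_mem_nhds {f : ℂ → ℂ} (hf : ContinuousOn f (Metric.closedBall 0 1))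
    (hinj : InjOn f (Metric.closedBall 0 1)) : f '' Metric.closedBall 0 1 ∈ 𝓝 (f 0) := by
  -- `F` extends the restriction of `f` to the disc continuously to the plane.
  let ρ : ℂ → ℂ := fun z => ((max 1 ‖z‖)⁻¹ : ℝ) • z
  have hρc : Continuous ρ := by
    have h1 : Continuous fun z : ℂ => max 1 ‖z‖ := by fun_prop
    exact (h1.inv₀ fun z => by positivity).smul continuous_id
  have hρm : ∀ z, ρ z ∈ Metric.closedBall (0 : ℂ) 1 := fun z => by
    have h1 : (0 : ℝ) < max 1 ‖z‖ := by positivity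
    rw [mem_closedBall_zero_iff, norm_smul, norm_inv, Real.norm_eq_abs, abs_of_pos h1,
      inv_mul_le_iff₀ h1, mul_one]
    exact le_max_right _ _
  have hρ : ∀ z ∈ Metric.closedBall (0 : ℂ) 1, ρ z = z := fun z hz => by
    rw [mem_closedBall_zero_iff] at hz
    simp [ρ, max_eq_left hz]
  let F : ℂ → ℂ := fun z => f (ρ z)
  have hFc : Continuous F := hf.comp_continuous hρc hρm
  have hF : ∀ z ∈ Metric.closedBall (0 : ℂ) 1, F z = f z := fun z hz => by simp only [F, hρ z hz]
  let e : ℝ → ℂ := fun θ => Complex.exp (θ * Complex.I)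
  have hec : Continuous e := by fun_prop
  have he : ∀ θ, ‖e θ‖ = 1 := fun θ => Complex.norm_exp_ofReal_mul_I θ
  have he0 : ∀ θ, e θ ≠ 0 := fun θ => Complex.exp_ne_zero _
  have heπ : ∀ θ, e (θ + Real.pi) = -e θ := fun θ => by
    simp only [e]; push_cast; rw [add_mul, Complex.exp_add, Complex.exp_pi_mul_I]; ring
  have he2π : ∀ θ, e (θ + 2 * Real.pi) = e θ := fun θ => by
    rw [two_mul, ← add_assoc, heπ, heπ, neg_neg]
  have hm0 : (0 : ℂ) ∈ Metric.closedBall (0 : ℂ) 1 := by simp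
  have hme : ∀ θ, e θ ∈ Metric.closedBall (0 : ℂ) 1 := fun θ => by simp [he]
  obtain ⟨z₀, hz₀, hmin⟩ := (isCompact_sphere (0 : ℂ) 1).exists_isMinOn
    (NormedSpace.sphere_nonempty.2 zero_le_one) (f := fun z => ‖f z - f 0‖)
    ((hf.mono Metric.sphere_subset_closedBall).sub continuousOn_const).norm
  have hδ : 0 < ‖f z₀ - f 0‖ := by
    refine norm_pos_iff.2 (sub_ne_zero.2 fun h => ?_)
    have := hinj (Metric.sphere_subset_closedBall hz₀) hm0 h
    simp [this] at hz₀
  refine Filter.mem_of_superset (Metric.ball_mem_nhds _ hδ) fun c hc => ?_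
  by_contra hcn
  rw [Metric.mem_ball, dist_eq_norm] at hc
  have hlt : ∀ θ, ‖c - f 0‖ < ‖f (e θ) - f 0‖ := fun θ =>
    hc.trans_le (hmin (by simp [he] : e θ ∈ Metric.sphere (0 : ℂ) 1))
  obtain ⟨L, hLc, hL⟩ := exists_continuous_log (g := fun z => F z - c) (by fun_prop)
    (fun z h => hcn ⟨ρ z, hρm z, sub_eq_zero.1 h⟩)
  have hne : ∀ θ, f (e θ) - f 0 ≠ 0 := fun θ =>
    norm_pos_iff.1 ((norm_nonneg _).trans_lt (hlt θ))
  have hFe : ∀ θ, F (e θ) = f (e θ) := fun θ => hF _ (hme θ)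
  -- A logarithm of `f z - f 0` along the circle that closes up.
  let u : ℝ → ℂ := fun θ => 1 + (f 0 - c) / (F (e θ) - f 0)
  have hu : ∀ θ, u θ ∈ Complex.slitPlane := fun θ => by
    refine Complex.mem_slitPlane_of_norm_lt_one ?_
    rw [norm_div, hFe, div_lt_one (norm_pos_iff.2 (hne θ)), norm_sub_rev]
    exact hlt θ
  let L₁ : ℝ → ℂ := fun θ => L (e θ) - Complex.log (u θ)
  have hL₁c : Continuous L₁ := by
    refine (hLc.comp hec).sub (Continuous.clog ?_ hu)
    refine continuous_const.add (continuous_const.div (by fun_prop) fun θ => ?_)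
    rw [hFe]; exact hne θ
  have hL₁ : ∀ θ, Complex.exp (L₁ θ) = f (e θ) - f 0 := fun θ => by
    have h0 : u θ ≠ 0 := Complex.slitPlane_ne_zero (hu θ)
    have hn := hne θ
    have hu' : f (e θ) - c = u θ * (f (e θ) - f 0) := by
      simp only [u, hFe]; field_simp; ring
    rw [Complex.exp_sub, Complex.exp_log h0, hL]
    simp only [hFe]
    rw [hu', mul_div_cancel_left₀ _ h0]
  have hL₁p : ∀ θ, L₁ (θ + 2 * Real.pi) = L₁ θ := fun θ => by simp only [L₁, u, he2π]
  -- The deformation to an odd loop, extended to all real times.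
  let s : ℝ → ℝ := fun t => min |t| 1
  have hs0 : ∀ t, 0 ≤ s t := fun t => le_min (abs_nonneg t) zero_le_one
  have hs1 : ∀ t, s t ≤ 1 := fun t => min_le_right _ _
  let a : ℝ × ℝ → ℂ := fun p => ((1 + s p.2)⁻¹ : ℝ) • e p.1
  let b : ℝ × ℝ → ℂ := fun p => -((s p.2 * (1 + s p.2)⁻¹ : ℝ) • e p.1)
  have hsc : Continuous fun p : ℝ × ℝ => (1 + s p.2)⁻¹ := by
    refine Continuous.inv₀ (by fun_prop) fun p => ?_
    have := hs0 p.2; positivity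
  have hac : Continuous a := by fun_prop
  have hbc : Continuous b := by fun_prop
  have ham : ∀ p, a p ∈ Metric.closedBall (0 : ℂ) 1 := fun p => by
    have := hs0 p.2
    rw [mem_closedBall_zero_iff, norm_smul, he, mul_one, Real.norm_of_nonneg (by positivity)]
    exact inv_le_one_of_one_le₀ (by linarith)
  have hbm : ∀ p, b p ∈ Metric.closedBall (0 : ℂ) 1 := fun p => by
    have := hs0 p.2
    have := hs1 p.2
    rw [mem_closedBall_zero_iff, norm_neg, norm_smul, he, mul_one,
      Real.norm_of_nonneg (by positivity), ← div_eq_mul_inv, div_le_one (by positivity)]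
    linarith
  have hab : ∀ p, a p ≠ b p := fun p h => by
    have h0 := hs0 p.2
    have h' : ((1 + s p.2)⁻¹ + s p.2 * (1 + s p.2)⁻¹ : ℝ) • e p.1 = 0 := by
      rw [add_smul, ← sub_neg_eq_add, sub_eq_zero]; exact h
    refine (smul_ne_zero ?_ (he0 p.1)) h'
    positivity
  obtain ⟨K, hKc, hK⟩ := exists_continuous_log (g := fun p => F (a p) - F (b p)) (by fun_prop)
    (fun p h => by
      rw [hF _ (ham p), hF _ (hbm p)] at h
      exact hab p (hinj (ham p) (hbm p) (sub_eq_zero.1 h)))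
  have hK0 : ∀ θ, Complex.exp (K (θ, 0)) = f (e θ) - f 0 := fun θ => by
    have h1 : a (θ, 0) = e θ := by simp [a, s]
    have h2 : b (θ, 0) = 0 := by simp [b, s]
    rw [hK]; simp only [h1, h2, hFe, hF 0 hm0]
  have hK1 : ∀ θ, Complex.exp (K (θ + Real.pi, 1)) = -Complex.exp (K (θ, 1)) := fun θ => by
    have h1 : a (θ + Real.pi, 1) = b (θ, 1) := by simp [a, b, s, heπ]
    have h2 : b (θ + Real.pi, 1) = a (θ, 1) := by simp [a, b, s, heπ]
    rw [hK, hK]; simp only [h1, h2, neg_sub]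
  have hKp : ∀ p : ℝ × ℝ, Complex.exp (K (p.1 + 2 * Real.pi, p.2) - K p) = 1 := fun p => by
    have h1 : a (p.1 + 2 * Real.pi, p.2) = a p := by simp only [a, he2π]
    have h2 : b (p.1 + 2 * Real.pi, p.2) = b p := by simp only [b, he2π]
    rw [Complex.exp_sub, hK, hK]; simp only [h1, h2]
    rw [← hK]; exact div_self (Complex.exp_ne_zero _)
  have hD := eq_of_exp_eq_const (by fun_prop) hKp (0, 0) (0, 1)
  have h0 := eq_of_exp_eq_const (k := fun θ => K (θ, 0) - L₁ θ) (w := 1) (by fun_prop)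
    (fun θ => by rw [Complex.exp_sub, hK0, hL₁]; exact div_self (hne θ)) (0 + 2 * Real.pi) 0
  have h1 := eq_of_exp_eq_const (k := fun θ => K (θ + Real.pi, 1) - K (θ, 1)) (w := -1)
    (by fun_prop)
    (fun θ => by rw [Complex.exp_sub, hK1, neg_div, div_self (Complex.exp_ne_zero _)])
    (0 + Real.pi) 0
  have h2 : Complex.exp (K (0 + Real.pi, 1) - K (0, 1)) = -1 := by
    rw [Complex.exp_sub, hK1, neg_div, div_self (Complex.exp_ne_zero _)]
  simp only [hL₁p] at h0
  have h3 : (0 : ℝ) + Real.pi + Real.pi = 0 + 2 * Real.pi := by ring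
  simp only [h3] at h1 hD
  have h4 : K (0 + Real.pi, 1) - K (0, 1) = 0 := by
    linear_combination (1 / 2 : ℂ) * h0 - (1 / 2 : ℂ) * hD - (1 / 2 : ℂ) * h1
  rw [h4, Complex.exp_zero] at h2
  norm_num at h2

/-- Invariance of domain for maps from the plane to a surface with boundary: the chart embeds a
neighbourhood in a half-plane, hence in the plane. -/
theorem image_mem_nhds_of_injOn {Z : Type*} [TopologicalSpace Z]
    [ChartedSpace (EuclideanHalfSpace 2) Z] {f : ℝ × ℝ → Z} {U : Set (ℝ × ℝ)} {p : ℝ × ℝ}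
    (hU : U ∈ 𝓝 p) (hf : ContinuousOn f U) (hinj : InjOn f U) : f '' U ∈ 𝓝 (f p) := by
  let c := chartAt (EuclideanHalfSpace 2) (f p)
  have hcs : c.source ∈ 𝓝 (f p) := chart_source_mem_nhds _ _
  have hV : U ∩ f ⁻¹' c.source ∈ 𝓝 p :=
    Filter.inter_mem hU ((hf.continuousAt hU).preimage_mem_nhds hcs)
  let φ : ℂ ≃L[ℝ] ℝ × ℝ := Complex.equivRealProdCLM
  let ψ : EuclideanSpace ℝ (Fin 2) ≃L[ℝ] ℂ :=
    ContinuousLinearEquiv.ofFinrankEq (by simp [Complex.finrank_real_complex])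
  have hφ : Continuous fun z : ℂ => p + φ z := by fun_prop
  have hV' : (fun z : ℂ => p + φ z) ⁻¹' (U ∩ f ⁻¹' c.source) ∈ 𝓝 (0 : ℂ) :=
    hφ.continuousAt.preimage_mem_nhds (by simpa using hV)
  obtain ⟨r, hr, hrV⟩ := Metric.nhds_basis_closedBall.mem_iff.1 hV'
  let j : ℂ → ℝ × ℝ := fun z => p + φ (r • z)
  have hj : Continuous j := by fun_prop
  have hjm : MapsTo j (Metric.closedBall 0 1) (U ∩ f ⁻¹' c.source) := fun z hz => by
    refine hrV (a := r • z) ?_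
    rw [mem_closedBall_zero_iff] at hz ⊢
    rw [norm_smul, Real.norm_of_nonneg hr.le]
    exact mul_le_of_le_one_right hr.le hz
  have hji : Function.Injective j := fun z w h =>
    smul_right_injective ℂ hr.ne' (φ.injective (add_left_cancel h))
  have hj0 : j 0 = p := by simp [j]
  let v : EuclideanHalfSpace 2 → ℂ := fun y => ψ y.1
  have hv : Continuous v := by fun_prop
  have hvi : Function.Injective v := ψ.injective.comp Subtype.val_injective
  let g : ℂ → ℂ := fun z => v (c (f (j z)))
  have hgc : ContinuousOn g (Metric.closedBall 0 1) :=
    hv.comp_continuousOn (c.continuousOn.comp (hf.comp hj.continuousOn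
      fun z hz => (hjm hz).1) fun z hz => (hjm hz).2)
  have hgi : InjOn g (Metric.closedBall 0 1) := fun z hz w hw h =>
    hji (hinj (hjm hz).1 (hjm hw).1 (c.injOn (hjm hz).2 (hjm hw).2 (hvi h)))
  have hg := image_unitDisc_mem_nhds hgc hgi
  have hpre : (fun y => v (c y)) ⁻¹' (g '' Metric.closedBall 0 1) ∈ 𝓝 (f p) := by
    refine ContinuousAt.preimage_mem_nhds
      (hv.continuousAt.comp (c.continuousAt (mem_chart_source _ _))) ?_
    have : g 0 = v (c (f p)) := by simp only [g, hj0]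
    exact this ▸ hg
  filter_upwards [hpre, hcs] with y hy hys
  obtain ⟨z, hz, h⟩ := hy
  have := c.injOn (hjm hz).2 hys (hvi h)
  exact ⟨j z, (hjm hz).1, this⟩

/-! ### Signs -/

theorem signed_lt_iff {s : ℤˣ} {a b : ℝ} :
    Signed s (· < ·) a b ↔ ((s : ℤ) : ℝ) * a < ((s : ℤ) : ℝ) * b := by
  rcases Int.units_eq_one_or s with rfl | rfl <;> simp [Signed]

theorem signed_one {α : Type*} {r : α → α → Prop} {a b : α} : Signed 1 r a b ↔ r a b := by
  simp [Signed]

theorem signed_neg_one {α : Type*} {r : α → α → Prop} {a b : α} : Signed (-1) r a b ↔ r b a := by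
  simp [Signed]

theorem Signed.sign_unique {s t : ℤˣ} {a b : ℝ} (h : Signed s (· < ·) a b)
    (h' : Signed t (· < ·) a b) : s = t := by
  rcases Int.units_eq_one_or s with rfl | rfl <;> rcases Int.units_eq_one_or t with rfl | rfl <;>
    simp_all [Signed] <;> exact (lt_asymm h h').elim

theorem Signed.trans {s : ℤˣ} {a b c : ℝ} (h : Signed s (· < ·) a b)
    (h' : Signed s (· < ·) b c) : Signed s (· < ·) a c :=
  signed_lt_iff.2 ((signed_lt_iff.1 h).trans (signed_lt_iff.1 h'))

theorem Signed.ne {s : ℤˣ} {a b : ℝ} (h : Signed s (· < ·) a b) : a ≠ b := by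
  rintro rfl
  exact lt_irrefl _ (signed_lt_iff.1 h)

theorem Signed.swap {s : ℤˣ} {a b : ℝ} (h : Signed s (· < ·) a b) :
    Signed (-s) (· < ·) b a := by
  rcases Int.units_eq_one_or s with rfl | rfl <;> simpa [Signed] using h

/-- The sign rule: if the order of `c` and `d` is related to that of `a` and `b` by `t`, a pair
`a`, `b` in the direction `s` forces the direction `t * s` on `c`, `d`. -/
theorem Signed.bind {s t : ℤˣ} {a b c d : ℝ} (h : Signed s (· < ·) a b)
    (h₁ : a < b → Signed t (· < ·) c d) (h₂ : b < a → Signed t (· < ·) d c) :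
    Signed (t * s) (· < ·) c d := by
  rcases h with ⟨rfl, h⟩ | ⟨rfl, h⟩
  · rw [mul_one]; exact h₁ h
  · rw [mul_neg_one]; exact (h₂ h).swap

/-- A function that is strictly monotone in the direction `t` maps pairs in the direction `s` to
pairs in the direction `t * s`. -/
theorem Signed.map {f : ℝ → ℝ} {T : Set ℝ} {s t : ℤˣ}
    (hf : ∀ a ∈ T, ∀ b ∈ T, a < b → Signed t (· < ·) (f a) (f b)) {a b : ℝ} (ha : a ∈ T)
    (hb : b ∈ T) (h : Signed s (· < ·) a b) : Signed (t * s) (· < ·) (f a) (f b) :=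
  h.bind (hf a ha b hb) (hf b hb a ha)

/-- The difference of two continuous functions that agree nowhere on a preconnected set has
constant sign there. -/
theorem IsPreconnected.exists_sign {E : Type*} [TopologicalSpace E] {s : Set E}
    (hs : IsPreconnected s) {f g : E → ℝ} (hf : ContinuousOn f s) (hg : ContinuousOn g s)
    (h : ∀ x ∈ s, f x ≠ g x) : ∃ e : ℤˣ, ∀ x ∈ s, Signed e (· < ·) (f x) (g x) := by
  by_cases h1 : ∀ x ∈ s, f x < g x
  · exact ⟨1, fun x hx => signed_one.2 (h1 x hx)⟩
  · push Not at h1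
    obtain ⟨a, ha, hab⟩ := h1
    refine ⟨-1, fun x hx => signed_neg_one.2 ?_⟩
    by_contra! hx'
    obtain ⟨z, hz, hz'⟩ := hs.intermediate_value₂ hx ha hf hg hx' hab
    exact h z hz hz'

/-- The increasing pairs of points of an interval form a connected set. -/
theorem Set.OrdConnected.isPreconnected_pairs {T : Set ℝ} (hT : T.OrdConnected) :
    IsPreconnected {z : ℝ × ℝ | (z.1 ∈ T ∧ z.2 ∈ T) ∧ z.1 < z.2} := by
  have h1 : Convex ℝ T := hT.convex
  refine Convex.isPreconnected ((h1.prod h1).inter (fun z hz w hw a b ha hb hab => ?_))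
  have hz' : z.1 < z.2 := hz
  have hw' : w.1 < w.2 := hw
  show a * z.1 + b * w.1 < a * z.2 + b * w.2
  rcases ha.eq_or_lt with rfl | ha
  · obtain rfl : b = 1 := by linarith
    linarith
  · nlinarith [mul_lt_mul_of_pos_left hz' ha, mul_le_mul_of_nonneg_left hw'.le hb]

namespace Strip

theorem level_one (S : Strip) : S.level 1 = S.v := by simp [level]

theorem level_neg_one (S : Strip) : S.level (-1) = S.u := by
  have : (-1 : ℤˣ) ≠ 1 := by decide
  simp [level, this]

theorem level_injective (S : Strip) : Function.Injective S.level := by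
  intro s t h
  have := S.u_lt_v
  rcases Int.units_eq_one_or s with rfl | rfl <;> rcases Int.units_eq_one_or t with rfl | rfl <;>
    simp_all [level_one, level_neg_one]

theorem level_notMem_Ioo (S : Strip) (s : ℤˣ) : S.level s ∉ Ioo S.u S.v := by
  rcases Int.units_eq_one_or s with rfl | rfl <;> simp [level_one, level_neg_one]

theorem mem_carrier_of_mem_Ioo (S : Strip) {z : ℝ × ℝ} (h : z.2 ∈ Ioo S.u S.v) :
    z ∈ S.carrier := S.open_subset ⟨mem_univ _, h⟩

theorem mem_Icc (S : Strip) {z : ℝ × ℝ} (h : z ∈ S.carrier) : z.2 ∈ Icc S.u S.v :=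
  (S.subset_closed h).2

theorem eq_level_of_notMem_Ioo (S : Strip) {z : ℝ × ℝ} (h : z ∈ S.carrier)
    (h' : z.2 ∉ Ioo S.u S.v) : ∃ s, z.2 = S.level s := by
  have h1 := S.mem_Icc h
  by_cases h2 : z.2 = S.u
  · exact ⟨-1, h2.trans S.level_neg_one.symm⟩
  · refine ⟨1, S.level_one ▸ le_antisymm h1.2 ?_⟩
    by_contra! h3
    exact h' ⟨lt_of_le_of_ne h1.1 (Ne.symm h2), h3⟩

/-- The side at which a strip is left in the direction `s`. -/
theorem signed_level (S : Strip) (s : ℤˣ) {y : ℝ} (h : y ∈ Ioo S.u S.v) :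
    Signed s (· < ·) y (S.level s) := by
  rcases Int.units_eq_one_or s with rfl | rfl
  · rw [signed_one, level_one]; exact h.2
  · rw [signed_neg_one, level_neg_one]; exact h.1

end Strip

/-! ### Points of a disjoint union of strips -/

namespace StripSum

variable {Λ : Type*} {S : Λ → Strip}

theorem ext_coord {p p' : StripSum S} (h : p.1 = p'.1) (hx : p.x = p'.x) (hy : p.y = p'.y) :
    p = p' := by
  obtain ⟨l, ⟨a, b⟩, hp⟩ := p
  obtain ⟨l', ⟨a', b'⟩, hp'⟩ := p'
  obtain rfl : l = l' := h
  obtain rfl : a = a' := hx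
  obtain rfl : b = b' := hy
  rfl

theorem continuous_x : Continuous (x : StripSum S → ℝ) :=
  continuous_sigma fun _ => continuous_fst.comp continuous_subtype_val

theorem continuous_y : Continuous (y : StripSum S → ℝ) :=
  continuous_sigma fun _ => continuous_snd.comp continuous_subtype_val

theorem mem_carrier (p : StripSum S) : (p.x, p.y) ∈ (S p.1).carrier := p.2.2

theorem y_mem_Icc (p : StripSum S) : p.y ∈ Icc (S p.1).u (S p.1).v := (S p.1).mem_Icc p.2.2

variable (S) in
open scoped Classical in
/-- The point of the strip `S l` with given coordinates; coordinates outside the strip are sent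
to a fixed interior point. -/
noncomputable def mk (l : Λ) (z : ℝ × ℝ) : StripSum S :=
  if h : z ∈ (S l).carrier then ⟨l, z, h⟩ else
    ⟨l, (0, ((S l).u + (S l).v) / 2), (S l).mem_carrier_of_mem_Ioo
      ⟨by linarith [(S l).u_lt_v], by linarith [(S l).u_lt_v]⟩⟩

@[simp] theorem mk_fst (l : Λ) (z : ℝ × ℝ) : (mk S l z).1 = l := by
  unfold mk; split_ifs <;> rfl

theorem mk_x {l : Λ} {z : ℝ × ℝ} (h : z ∈ (S l).carrier) : (mk S l z).x = z.1 := by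
  rw [mk, dif_pos h]; rfl

theorem mk_y {l : Λ} {z : ℝ × ℝ} (h : z ∈ (S l).carrier) : (mk S l z).y = z.2 := by
  rw [mk, dif_pos h]; rfl

theorem mk_eta {l : Λ} {p : StripSum S} (h : p.1 = l) : mk S l (p.x, p.y) = p := by
  subst h
  exact ext_coord (mk_fst _ _) (mk_x p.mem_carrier) (mk_y p.mem_carrier)

theorem continuousOn_mk (l : Λ) : ContinuousOn (mk S l) (S l).carrier := by
  rw [continuousOn_iff_continuous_domRestrict]
  have : (S l).carrier.domRestrict (mk S l) = fun z => ⟨l, z⟩ := by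
    ext1 z
    simp [domRestrict, mk]
  rw [this]
  exact continuous_sigmaMk (σ := fun l => (S l).carrier)

theorem isInterior_mk {l : Λ} {z : ℝ × ℝ} (h : z.2 ∈ Ioo (S l).u (S l).v) :
    (mk S l z).IsInterior := by
  unfold IsInterior
  rw [mk_y ((S l).mem_carrier_of_mem_Ioo h), mk_fst]
  exact h

theorem IsInterior.mem {p : StripSum S} (h : p.IsInterior) {l : Λ} (hl : p.1 = l) :
    p.y ∈ Ioo (S l).u (S l).v := hl ▸ h

/-- Every point is a limit of interior points on the same vertical line. -/
theorem tendsto_mk {l : Λ} {p : StripSum S} (hl : p.1 = l) :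
    Filter.Tendsto (fun t => mk S l (p.x, t)) (𝓝[Ioo (S l).u (S l).v] p.y) (𝓝 p) := by
  subst hl
  have h1 : Filter.Tendsto (fun t : ℝ => (p.x, t)) (𝓝[Ioo (S p.1).u (S p.1).v] p.y)
      (𝓝[(S p.1).carrier] (p.x, p.y)) := by
    refine tendsto_nhdsWithin_iff.2 ⟨?_, ?_⟩
    · exact ((Continuous.prodMk_right p.x).tendsto p.y).mono_left nhdsWithin_le_nhds
    · filter_upwards [self_mem_nhdsWithin] with t ht
      exact (S p.1).mem_carrier_of_mem_Ioo ht
  have h2 := (continuousOn_mk (S := S) p.1 (p.x, p.y) p.mem_carrier).tendsto.comp h1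
  rwa [mk_eta rfl] at h2

theorem neBot_nhdsWithin {l : Λ} {t : ℝ} (h : t ∈ Icc (S l).u (S l).v) :
    (𝓝[Ioo (S l).u (S l).v] t).NeBot := by
  rw [← mem_closure_iff_nhdsWithin_neBot, closure_Ioo (S l).u_lt_v.ne]
  exact h

theorem exists_isInterior_mem {p : StripSum S} {O : Set (StripSum S)} (hO : O ∈ 𝓝 p) :
    ∃ w ∈ O, w.IsInterior := by
  have := neBot_nhdsWithin p.y_mem_Icc
  obtain ⟨t, h1, h2⟩ := ((tendsto_mk (p := p) rfl).eventually hO |>.and self_mem_nhdsWithin).exists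
  exact ⟨_, h1, isInterior_mk h2⟩

end StripSum

namespace HalfEdge

variable {Λ : Type*} {S : Λ → Strip}

theorem interval_subset_trace (X : HalfEdge S) : X.interval ⊆ (S X.vertex).trace X.side := by
  obtain ⟨a, _, h⟩ := X.isComponent
  rw [h]
  exact connectedComponentIn_subset _ _

/-- The point of a boundary interval with a given horizontal coordinate. -/
noncomputable def pt (X : HalfEdge S) (a : ℝ) : StripSum S :=
  StripSum.mk S X.vertex (a, (S X.vertex).level X.side)

theorem pt_x {X : HalfEdge S} {a : ℝ} (h : a ∈ X.interval) : (X.pt a).x = a :=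
  StripSum.mk_x (X.interval_subset_trace h)

theorem pt_mem {X : HalfEdge S} {a : ℝ} (h : a ∈ X.interval) : X.pt a ∈ X.toSet :=
  ⟨StripSum.mk_fst _ _, by rwa [pt_x h], StripSum.mk_y (X.interval_subset_trace h)⟩

theorem pt_of_mem {X : HalfEdge S} {p : StripSum S} (h : p ∈ X.toSet) : X.pt p.x = p := by
  rw [pt, ← h.2.2, StripSum.mk_eta h.1]

theorem continuousOn_pt (X : HalfEdge S) : ContinuousOn X.pt X.interval :=
  (StripSum.continuousOn_mk X.vertex).comp (by fun_prop) fun _ h => X.interval_subset_trace h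

theorem not_isInterior {X : HalfEdge S} {p : StripSum S} (h : p ∈ X.toSet) :
    ¬ p.IsInterior := fun h' =>
  (S X.vertex).level_notMem_Ioo X.side (h.2.2 ▸ h'.mem h.1)

theorem eq_of_mem_toSet {X Y : HalfEdge S} {p : StripSum S} (hX : p ∈ X.toSet)
    (hY : p ∈ Y.toSet) : X = Y := by
  have hv : X.vertex = Y.vertex := hX.1.symm.trans hY.1
  refine eq_of_mem hv ((S X.vertex).level_injective ?_) hX.2.1 hY.2.1
  rw [← hX.2.2, hY.2.2, hv]

theorem exists_interval_mem {l : Λ} {s : ℤˣ} {a : ℝ} (h : a ∈ (S l).trace s) :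
    ∃ X : HalfEdge S, X.vertex = l ∧ X.side = s ∧ a ∈ X.interval :=
  ⟨⟨l, s, _, a, h, rfl⟩, rfl, rfl, mem_connectedComponentIn h⟩

theorem exists_mem_toSet {p : StripSum S} (h : ¬ p.IsInterior) :
    ∃ X : HalfEdge S, p ∈ X.toSet := by
  obtain ⟨s, hs⟩ := (S p.1).eq_level_of_notMem_Ioo p.mem_carrier h
  obtain ⟨X, h1, h2, h3⟩ := exists_interval_mem (S := S) (l := p.1) (s := s) (a := p.x)
    (by show (p.x, (S p.1).level s) ∈ (S p.1).carrier; rw [← hs]; exact p.mem_carrier)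
  refine ⟨X, h1.symm, h3, ?_⟩
  rw [h1, h2]; exact hs

theorem toSet_nonempty (X : HalfEdge S) : X.toSet.Nonempty := by
  obtain ⟨a, ha⟩ := X.interval_nonempty
  exact ⟨_, pt_mem ha⟩

end HalfEdge

/-! ### Gluing along one boundary interval -/

namespace StripedAtlas

variable {Λ Γ Z : Type*} [TopologicalSpace Z]

/-- A homeomorphism between boundary intervals is strictly monotone in the direction of its
orientation. -/
theorem signed_ori {S : Λ → Strip} {I J : HalfEdge S} (e : I.toSet ≃ₜ J.toSet) {p p' : I.toSet}
    (h : p.1.x < p'.1.x) : Signed (ori e) (· < ·) (e p).1.x (e p').1.x := by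
  classical
  let P := {z : ℝ × ℝ | (z.1 ∈ I.interval ∧ z.2 ∈ I.interval) ∧ z.1 < z.2}
  let j : I.interval → I.toSet := fun a => ⟨I.pt a, HalfEdge.pt_mem a.2⟩
  have hj : Continuous j :=
    Continuous.subtype_mk (continuousOn_iff_continuous_domRestrict.1 I.continuousOn_pt) _
  let f : P → ℝ := fun z => (e (j ⟨z.1.1, z.2.1.1⟩)).1.x
  let g : P → ℝ := fun z => (e (j ⟨z.1.2, z.2.1.2⟩)).1.x
  have hxc := StripSum.continuous_x (S := S)
  have hf : Continuous f := by fun_prop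
  have hg : Continuous g := by fun_prop
  have hP : PreconnectedSpace P :=
    isPreconnected_iff_preconnectedSpace.1 I.ordConnected_interval.isPreconnected_pairs
  obtain ⟨s, hs⟩ := isPreconnected_univ.exists_sign hf.continuousOn hg.continuousOn
    (fun z _ hfg => by
      have h1 := e.injective (Subtype.ext (StripSum.ext_coord ((e _).2.1.trans (e _).2.1.symm) hfg
        ((e _).2.2.2.trans (e _).2.2.2.symm)))
      have h2 := congrArg (fun p : I.toSet => p.1.x) h1
      simp only [j] at h2
      rw [HalfEdge.pt_x z.2.1.1, HalfEdge.pt_x z.2.1.2] at h2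
      exact z.2.2.ne h2)
  have hs' : ∀ p p' : I.toSet, p.1.x < p'.1.x → Signed s (· < ·) (e p).1.x (e p').1.x := by
    intro p p' hpp
    have h1 := hs ⟨(p.1.x, p'.1.x), ⟨p.2.2.1, p'.2.2.1⟩, hpp⟩ (mem_univ _)
    simp only [f, g, j, HalfEdge.pt_of_mem p.2, HalfEdge.pt_of_mem p'.2] at h1
    exact h1
  have : ori e = s := by
    unfold ori
    split_ifs with hall
    · exact Signed.sign_unique (signed_one.2 (hall p p' h)) (hs' p p' h)
    · rcases Int.units_eq_one_or s with rfl | rfl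
      · exact absurd (fun p p' hpp => signed_one.1 (hs' p p' hpp)) hall
      · rfl
  rw [this]
  exact hs' p p' h

theorem signed_ori_symm {S : Λ → Strip} {I J : HalfEdge S} (e : I.toSet ≃ₜ J.toSet)
    {r r' : J.toSet} (h : r.1.x < r'.1.x) :
    Signed (ori e) (· < ·) (e.symm r).1.x (e.symm r').1.x := by
  obtain ⟨p, rfl⟩ := e.surjective r
  obtain ⟨p', rfl⟩ := e.surjective r'
  simp only [e.symm_apply_apply]
  rcases lt_trichotomy p.1.x p'.1.x with h' | h' | h'
  · have := signed_ori e h'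
    rcases Int.units_eq_one_or (ori e) with hs | hs <;> rw [hs] at this ⊢
    · exact signed_one.2 h'
    · exact absurd (signed_neg_one.1 this) h.not_gt
  · have : p = p' := Subtype.ext (StripSum.ext_coord (p.2.1.trans p'.2.1.symm) h'
      (p.2.2.2.trans p'.2.2.2.symm))
    simp [this] at h
  · have := signed_ori e h'
    rcases Int.units_eq_one_or (ori e) with hs | hs <;> rw [hs] at this ⊢
    · exact absurd (signed_one.1 this) h.not_gt
    · exact signed_neg_one.2 h'

variable (A : StripedAtlas Λ Γ Z)

theorem q_glue (γ : Γ) (p : (A.Y γ).toSet) : A.q (A.glue γ p).1 = A.q p.1 := by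
  have h1 := congrArg Subtype.val ((A.closedEmbedding_X γ).isEmbedding.toHomeomorph.apply_symm_apply
    ((Homeomorph.setCongr (by rw [range_domRestrict, range_domRestrict, A.image_eq γ]))
      ((A.closedEmbedding_Y γ).isEmbedding.toHomeomorph p)))
  exact h1

variable {A}

theorem injOn_glued {I : HalfEdge A.S} (hI : A.ξ I ≠ I) : InjOn A.q I.toSet := by
  obtain ⟨γ, rfl | rfl⟩ := A.exists_glued hI
  · exact injOn_iff_injective.2 (A.closedEmbedding_X γ).injective
  · exact injOn_iff_injective.2 (A.closedEmbedding_Y γ).injective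

theorem ξ_ne (A : StripedAtlas Λ Γ Z) {I : HalfEdge A.S} (hI : A.ξ I ≠ I) :
    A.ξ (A.ξ I) ≠ A.ξ I := by
  rw [A.ξ_involutive]; exact hI.symm

theorem exists_homeomorph_glued {I : HalfEdge A.S} (hI : A.ξ I ≠ I) :
    ∃ e : I.toSet ≃ₜ (A.ξ I).toSet, (∀ p, A.q (e p).1 = A.q p.1) ∧
      ∀ p p' : I.toSet, p.1.x < p'.1.x →
        Signed (A.σ ⟨I, hI⟩) (· < ·) (e p).1.x (e p').1.x := by
  obtain ⟨γ, rfl | rfl⟩ := A.exists_glued hI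
  · rw [A.σ_eq hI (Or.inl rfl), A.ξ_X]
    refine ⟨(A.glue γ).symm, fun p => ?_, fun p p' h => signed_ori_symm _ h⟩
    rw [← A.q_glue, Homeomorph.apply_symm_apply]
  · rw [A.σ_eq hI (Or.inr rfl), A.ξ_Y]
    exact ⟨A.glue γ, A.q_glue γ, fun p p' h => signed_ori _ h⟩

/-- The gluing of a boundary interval to its partner in terms of the horizontal coordinate. -/
theorem exists_transfer {I : HalfEdge A.S} (hI : A.ξ I ≠ I) :
    ∃ π : ℝ → ℝ, ContinuousOn π I.interval ∧ BijOn π I.interval (A.ξ I).interval ∧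
      (∀ a ∈ I.interval, A.q ((A.ξ I).pt (π a)) = A.q (I.pt a)) ∧
      ∀ a ∈ I.interval, ∀ b ∈ I.interval, a < b → Signed (A.σ ⟨I, hI⟩) (· < ·) (π a) (π b) := by
  classical
  obtain ⟨e, he, hs⟩ := exists_homeomorph_glued hI
  let j : I.interval → I.toSet := fun a => ⟨I.pt a, HalfEdge.pt_mem a.2⟩
  have hj : Continuous j :=
    Continuous.subtype_mk (continuousOn_iff_continuous_domRestrict.1 I.continuousOn_pt) _
  let π : ℝ → ℝ := fun a => if h : a ∈ I.interval then (e (j ⟨a, h⟩)).1.x else 0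
  have hπ : ∀ (a : ℝ) (h : a ∈ I.interval), π a = (e (j ⟨a, h⟩)).1.x := fun a h => dif_pos h
  have hmono : ∀ a ∈ I.interval, ∀ b ∈ I.interval, a < b →
      Signed (A.σ ⟨I, hI⟩) (· < ·) (π a) (π b) := fun a ha b hb hab => by
    rw [hπ a ha, hπ b hb]
    refine hs _ _ ?_
    simp only [j]
    rwa [HalfEdge.pt_x ha, HalfEdge.pt_x hb]
  refine ⟨π, ?_, ⟨fun a ha => ?_, fun a ha b hb hab => ?_, fun c hc => ?_⟩, fun a ha => ?_, hmono⟩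
  · rw [continuousOn_iff_continuous_domRestrict]
    have : I.interval.domRestrict π = fun a => (e (j a)).1.x := by
      ext1 a
      exact hπ a a.2
    rw [this]
    have hxc := StripSum.continuous_x (S := A.S)
    fun_prop
  · rw [hπ a ha]; exact (e _).2.2.1
  · by_contra hne
    rcases lt_or_gt_of_ne hne with h | h
    · exact (hmono a ha b hb h).ne hab
    · exact (hmono b hb a ha h).ne hab.symm
  · let r : (A.ξ I).toSet := ⟨(A.ξ I).pt c, HalfEdge.pt_mem hc⟩
    refine ⟨(e.symm r).1.x, (e.symm r).2.2.1, ?_⟩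
    rw [hπ _ (e.symm r).2.2.1]
    have : j ⟨(e.symm r).1.x, (e.symm r).2.2.1⟩ = e.symm r :=
      Subtype.ext (HalfEdge.pt_of_mem (e.symm r).2)
    rw [this, e.apply_symm_apply]
    exact HalfEdge.pt_x hc
  · rw [hπ a ha, HalfEdge.pt_of_mem (e _).2, he]

end StripedAtlas

/-! ### Fibres of a striped atlas on a surface -/

namespace HalfEdge

variable {Λ : Type*} {S : Λ → Strip}

/-- The point at horizontal coordinate `z.1` and at distance `|z.2|` from the boundary interval
`I` in its strip. -/
noncomputable def collar (I : HalfEdge S) (z : ℝ × ℝ) : StripSum S :=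
  StripSum.mk S I.vertex (z.1, (S I.vertex).level I.side - ((I.side : ℤ) : ℝ) * |z.2|)

theorem collar_height_mem (I : HalfEdge S) {b : ℝ} (hb : b ≠ 0)
    (hb' : |b| < (S I.vertex).v - (S I.vertex).u) :
    (S I.vertex).level I.side - ((I.side : ℤ) : ℝ) * |b| ∈
      Ioo (S I.vertex).u (S I.vertex).v := by
  have h0 : 0 < |b| := abs_pos.2 hb
  rcases Int.units_eq_one_or I.side with hs | hs <;> rw [hs]
  · rw [Strip.level_one]; constructor <;> push_cast <;> linarith
  · rw [Strip.level_neg_one]; constructor <;> push_cast <;> linarith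

theorem collar_mem_carrier (I : HalfEdge S) {z : ℝ × ℝ} (ha : z.1 ∈ I.interval)
    (hb : |z.2| < (S I.vertex).v - (S I.vertex).u) :
    (z.1, (S I.vertex).level I.side - ((I.side : ℤ) : ℝ) * |z.2|) ∈ (S I.vertex).carrier := by
  by_cases h : z.2 = 0
  · rw [h, abs_zero, mul_zero, sub_zero]
    exact I.interval_subset_trace ha
  · exact (S I.vertex).mem_carrier_of_mem_Ioo (I.collar_height_mem h hb)

theorem continuousOn_collar (I : HalfEdge S) : ContinuousOn I.collar
    {z | z.1 ∈ I.interval ∧ |z.2| < (S I.vertex).v - (S I.vertex).u} :=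
  (StripSum.continuousOn_mk I.vertex).comp (by fun_prop)
    fun _ h => I.collar_mem_carrier h.1 h.2

theorem collar_zero (I : HalfEdge S) (a : ℝ) : I.collar (a, 0) = I.pt a := by
  simp [collar, pt]

theorem isInterior_collar (I : HalfEdge S) {z : ℝ × ℝ} (h : z.2 ≠ 0)
    (hb : |z.2| < (S I.vertex).v - (S I.vertex).u) : (I.collar z).IsInterior :=
  StripSum.isInterior_mk (I.collar_height_mem h hb)

theorem collar_injective (I : HalfEdge S) {z w : ℝ × ℝ} (hz : z.1 ∈ I.interval)
    (hz' : |z.2| < (S I.vertex).v - (S I.vertex).u) (hw : w.1 ∈ I.interval)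
    (hw' : |w.2| < (S I.vertex).v - (S I.vertex).u) (h : I.collar z = I.collar w) :
    z.1 = w.1 ∧ |z.2| = |w.2| := by
  have hx := congrArg StripSum.x h
  have hy := congrArg StripSum.y h
  simp only [collar] at hx hy
  rw [StripSum.mk_x (I.collar_mem_carrier hz hz'),
    StripSum.mk_x (I.collar_mem_carrier hw hw')] at hx
  rw [StripSum.mk_y (I.collar_mem_carrier hz hz'),
    StripSum.mk_y (I.collar_mem_carrier hw hw')] at hy
  refine ⟨hx, mul_left_cancel₀ (a := ((I.side : ℤ) : ℝ)) (by simp) ?_⟩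
  exact sub_right_injective hy

end HalfEdge

namespace StripedAtlas

variable {Λ Γ Z : Type*} [TopologicalSpace Z] {A : StripedAtlas Λ Γ Z}

theorem eq_of_isInterior_of_isInterior {p p' : StripSum A.S} (hp : p.IsInterior)
    (hp' : p'.IsInterior) (h : A.q p = A.q p') : p = p' := by
  have key : ∀ w : StripSum A.S, w.IsInterior → w ∈ (⋃ γ, (A.X γ).toSet ∪ (A.Y γ).toSet)ᶜ := by
    intro w hw hm
    obtain ⟨γ, h | h⟩ := mem_iUnion.1 hm
    · exact HalfEdge.not_isInterior h hw
    · exact HalfEdge.not_isInterior h hw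
  exact A.injOn (key p hp) (key p' hp') h

theorem exists_isInterior_of_image_mem_nhds {D O : Set (StripSum A.S)} {w : StripSum A.S}
    (hD : A.q '' D ∈ 𝓝 (A.q w)) (hO : O ∈ 𝓝 w) :
    ∃ w' ∈ O, w'.IsInterior ∧ ∃ d ∈ D, A.q d = A.q w' := by
  obtain ⟨w', h1, h2⟩ := StripSum.exists_isInterior_mem (Filter.inter_mem hO
    (A.isQuotientMap.continuous.continuousAt.preimage_mem_nhds hD))
  exact ⟨w', h1.1, h2, h1.2⟩

theorem ξ_eq_of_fixed {I : HalfEdge A.S} (hI : A.ξ I = I) :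
    (∀ γ, A.X γ ≠ I) ∧ ∀ γ, A.Y γ ≠ I := by
  constructor
  · rintro γ rfl
    rw [A.ξ_X] at hI
    exact A.X_ne_Y γ γ hI.symm
  · rintro γ rfl
    rw [A.ξ_Y] at hI
    exact A.X_ne_Y γ γ hI

variable [ChartedSpace (EuclideanHalfSpace 2) Z]

/-- No point is glued to an interior point: a disc around an interior point `p` covers a
neighbourhood of `q p` by invariance of domain, so the interior points near any other point of
the fibre would be identified with points of the disc. -/
theorem eq_of_isInterior {p p' : StripSum A.S} (hp : p.IsInterior) (h : A.q p = A.q p') :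
    p = p' := by
  by_contra hne
  obtain ⟨O, O', hO, hO', hpO, hpO', hdisj⟩ := t2_separation hne
  let V : Set (ℝ × ℝ) := univ ×ˢ Ioo (A.S p.1).u (A.S p.1).v
  have hV : IsOpen V := isOpen_univ.prod isOpen_Ioo
  have hmk : ContinuousOn (StripSum.mk A.S p.1) V :=
    (StripSum.continuousOn_mk p.1).mono (A.S p.1).open_subset
  have hU : IsOpen (V ∩ StripSum.mk A.S p.1 ⁻¹' O) := hmk.isOpen_inter_preimage hV hO
  have hpU : (p.x, p.y) ∈ V ∩ StripSum.mk A.S p.1 ⁻¹' O :=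
    ⟨⟨mem_univ _, hp⟩, by rw [mem_preimage, StripSum.mk_eta rfl]; exact hpO⟩
  have himg := image_mem_nhds_of_injOn (f := fun z => A.q (StripSum.mk A.S p.1 z))
    (hU.mem_nhds hpU)
    (A.isQuotientMap.continuous.comp_continuousOn (hmk.mono inter_subset_left))
    (fun z hz w hw hzw => by
      have h1 := eq_of_isInterior_of_isInterior (StripSum.isInterior_mk hz.1.2)
        (StripSum.isInterior_mk hw.1.2) hzw
      have h2 := congrArg StripSum.x h1
      have h3 := congrArg StripSum.y h1
      rw [StripSum.mk_x ((A.S p.1).open_subset hz.1),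
        StripSum.mk_x ((A.S p.1).open_subset hw.1)] at h2
      rw [StripSum.mk_y ((A.S p.1).open_subset hz.1),
        StripSum.mk_y ((A.S p.1).open_subset hw.1)] at h3
      exact Prod.ext h2 h3)
  simp only [StripSum.mk_eta, h] at himg
  rw [← image_image] at himg
  obtain ⟨w, hwO, hw, d, ⟨z, hz, rfl⟩, hd⟩ :=
    exists_isInterior_of_image_mem_nhds himg (hO'.mem_nhds hpO')
  have := eq_of_isInterior_of_isInterior (StripSum.isInterior_mk hz.1.2) hw hd
  exact hdisj.le_bot ⟨hz.2, this ▸ hwO⟩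

/-- Two glued points are not glued to a third one: half-discs around them in their strips
together form a disc, which covers a neighbourhood by invariance of domain. -/
theorem eq_or_eq_of_glued {I : HalfEdge A.S} (hI : A.ξ I ≠ I) {p r w : StripSum A.S}
    (hp : p ∈ I.toSet) (hr : r ∈ (A.ξ I).toSet) (hpr : A.q p = A.q r) (hpw : A.q p = A.q w) :
    w = p ∨ w = r := by
  classical
  by_contra! hne
  have hpr' : p ≠ r := fun h => hI (HalfEdge.eq_of_mem_toSet hp (h ▸ hr)).symm
  obtain ⟨O₁, Q₁, hO₁, hQ₁, hpO₁, hwQ₁, hd₁⟩ := t2_separation hne.1.symm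
  obtain ⟨O₂, Q₂, hO₂, hQ₂, hrO₂, hwQ₂, hd₂⟩ := t2_separation hne.2.symm
  obtain ⟨O₃, Q₃, hO₃, hQ₃, hpO₃, hrQ₃, hd₃⟩ := t2_separation hpr'
  obtain ⟨π, hπc, hπb, hπq, -⟩ := exists_transfer hI
  have hπp : (A.ξ I).pt (π p.x) = r := by
    refine injOn_glued (A.ξ_ne hI) (HalfEdge.pt_mem (hπb.mapsTo hp.2.1)) hr ?_
    rw [hπq _ hp.2.1, HalfEdge.pt_of_mem hp, hpr]
  set J := A.ξ I with hJ
  let dI := (A.S I.vertex).v - (A.S I.vertex).u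
  let dJ := (A.S J.vertex).v - (A.S J.vertex).u
  have hdI : 0 < dI := sub_pos.2 (A.S I.vertex).u_lt_v
  have hdJ : 0 < dJ := sub_pos.2 (A.S J.vertex).u_lt_v
  let W : Set (ℝ × ℝ) := I.interval ×ˢ {b | |b| < min dI dJ}
  have hW : IsOpen W := I.isOpen_interval.prod
    (isOpen_lt continuous_abs continuous_const)
  have hWI : ∀ z ∈ W, |z.2| < dI := fun z hz => hz.2.trans_le (min_le_left _ _)
  have hWJ : ∀ z ∈ W, |z.2| < dJ := fun z hz => hz.2.trans_le (min_le_right _ _)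
  let f : ℝ × ℝ → StripSum A.S := I.collar
  let g : ℝ × ℝ → StripSum A.S := fun z => J.collar (π z.1, z.2)
  have hf : ContinuousOn f W := I.continuousOn_collar.mono fun z hz => ⟨hz.1, hWI z hz⟩
  have hg : ContinuousOn g W := by
    have h1 : ContinuousOn (fun z : ℝ × ℝ => (π z.1, z.2)) W :=
      (hπc.comp continuousOn_fst fun z hz => hz.1).prodMk continuousOn_snd
    exact ContinuousOn.comp (g := J.collar) J.continuousOn_collar h1
      fun z hz => ⟨hπb.mapsTo hz.1, hWJ z hz⟩
  let U := (W ∩ f ⁻¹' (O₁ ∩ O₃)) ∩ (W ∩ g ⁻¹' (O₂ ∩ Q₃))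
  have hU : IsOpen U := (hf.isOpen_inter_preimage hW (hO₁.inter hO₃)).inter
    (hg.isOpen_inter_preimage hW (hO₂.inter hQ₃))
  have hf0 : f (p.x, 0) = p := by simp only [f, HalfEdge.collar_zero, HalfEdge.pt_of_mem hp]
  have hg0 : g (p.x, 0) = r := by simp only [g, HalfEdge.collar_zero, hπp]
  have hpW : (p.x, (0 : ℝ)) ∈ W := ⟨hp.2.1, by simp [hdI, hdJ]⟩
  have hpU : (p.x, (0 : ℝ)) ∈ U :=
    ⟨⟨hpW, by rw [mem_preimage, hf0]; exact ⟨hpO₁, hpO₃⟩⟩,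
      ⟨hpW, by rw [mem_preimage, hg0]; exact ⟨hrO₂, hrQ₃⟩⟩⟩
  -- The disc: the collar of `I` on the upper half and the collar of its partner on the lower half.
  let Φ : ℝ × ℝ → StripSum A.S := fun z => if 0 ≤ z.2 then f z else g z
  have hqΦ : ContinuousOn (fun z => A.q (Φ z)) U := by
    have h1 : (fun z => A.q (Φ z)) = fun z => if 0 ≤ z.2 then A.q (f z) else A.q (g z) := by
      ext1 z; simp only [Φ]; split_ifs <;> rfl
    rw [h1]
    refine ContinuousOn.mono (s := W) (ContinuousOn.if ?_ ?_ ?_) fun z hz => hz.1.1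
    · rintro ⟨a, b⟩ ⟨hz, hfr⟩
      have h0 : (0 : ℝ) = b := frontier_le_subset_eq continuous_const continuous_snd hfr
      subst h0
      simp only [f, g, HalfEdge.collar_zero]
      exact (hπq a hz.1).symm
    · exact (A.isQuotientMap.continuous.comp_continuousOn hf).mono inter_subset_left
    · exact (A.isQuotientMap.continuous.comp_continuousOn hg).mono inter_subset_left
  have hint : ∀ z ∈ U, z.2 ≠ 0 → (Φ z).IsInterior := by
    intro z hz h0
    simp only [Φ]
    split_ifs
    · exact I.isInterior_collar h0 (hWI z hz.1.1)
    · exact J.isInterior_collar (z := (π z.1, z.2)) h0 (hWJ z hz.1.1)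
  -- The two halves land in disjoint open sets, so `Φ` is injective.
  have hΦinj : ∀ z ∈ U, ∀ z' ∈ U, Φ z = Φ z' → z = z' := by
    intro z hz z' hz' h
    simp only [Φ] at h
    split_ifs at h with h1 h2 h2
    · obtain ⟨h3, h4⟩ := I.collar_injective hz.1.1.1 (hWI z hz.1.1) hz'.1.1.1 (hWI z' hz'.1.1) h
      rw [abs_of_nonneg h1, abs_of_nonneg h2] at h4
      exact Prod.ext h3 h4
    · exact (hd₃.le_bot ⟨hz.1.2.2, h ▸ hz'.2.2.2⟩).elim
    · exact (hd₃.le_bot ⟨hz'.1.2.2, h ▸ hz.2.2.2⟩).elim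
    · obtain ⟨h3, h4⟩ := J.collar_injective (z := (π z.1, z.2)) (w := (π z'.1, z'.2))
        (hπb.mapsTo hz.1.1.1) (hWJ z hz.1.1) (hπb.mapsTo hz'.1.1.1) (hWJ z' hz'.1.1) h
      simp only at h4
      rw [abs_of_neg (not_le.1 h1), abs_of_neg (not_le.1 h2)] at h4
      exact Prod.ext (hπb.injOn hz.1.1.1 hz'.1.1.1 h3) (neg_injective h4)
  have hinj : InjOn (fun z => A.q (Φ z)) U := by
    intro z hz z' hz' h
    by_cases h0 : z.2 = 0
    · by_cases h0' : z'.2 = 0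
      · simp only [Φ, h0, h0', le_refl, if_true] at h
        obtain ⟨a, b⟩ := z
        obtain ⟨a', b'⟩ := z'
        obtain rfl : b = 0 := h0
        obtain rfl : b' = 0 := h0'
        simp only [f, HalfEdge.collar_zero] at h
        have h1 := injOn_glued hI (HalfEdge.pt_mem hz.1.1.1) (HalfEdge.pt_mem hz'.1.1.1) h
        have h2 := congrArg StripSum.x h1
        rw [HalfEdge.pt_x hz.1.1.1, HalfEdge.pt_x hz'.1.1.1] at h2
        exact Prod.ext h2 rfl
      · exact hΦinj z hz z' hz' (eq_of_isInterior (hint z' hz' h0') h.symm).symm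
    · exact hΦinj z hz z' hz' (eq_of_isInterior (hint z hz h0) h)
  have himg := image_mem_nhds_of_injOn (hU.mem_nhds hpU) hqΦ hinj
  have hΦp : A.q (Φ (p.x, 0)) = A.q w := by
    simp only [Φ, le_refl, if_true, hf0, hpw]
  simp only [hΦp] at himg
  rw [← image_image] at himg
  obtain ⟨w', hwO, hw, d, ⟨z, hz, rfl⟩, hd⟩ := exists_isInterior_of_image_mem_nhds himg
    ((hQ₁.inter hQ₂).mem_nhds ⟨hwQ₁, hwQ₂⟩)
  have hw' : w' = Φ z := eq_of_isInterior hw hd.symm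
  simp only [Φ] at hw'
  split_ifs at hw'
  · exact hd₁.le_bot ⟨hz.1.2.1, hw' ▸ hwO.1⟩
  · exact hd₂.le_bot ⟨hz.2.2.1, hw' ▸ hwO.2⟩

/-- On a surface, a striped atlas identifies only the points that the gluing maps identify. -/
theorem eq_or_exists_glued {p p' : StripSum A.S} (h : A.q p = A.q p') :
    p = p' ∨ ∃ I : HalfEdge A.S, A.ξ I ≠ I ∧ p ∈ I.toSet ∧ p' ∈ (A.ξ I).toSet := by
  have key : ∀ p p' : StripSum A.S, A.q p = A.q p' → ∀ I : HalfEdge A.S, A.ξ I ≠ I →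
      p ∈ I.toSet → p = p' ∨ p' ∈ (A.ξ I).toSet := by
    intro p p' h I hI hp
    obtain ⟨e, he, -⟩ := exists_homeomorph_glued hI
    rcases eq_or_eq_of_glued hI hp (e ⟨p, hp⟩).2 (he ⟨p, hp⟩).symm h with h' | h'
    · exact Or.inl h'.symm
    · exact Or.inr (h' ▸ (e ⟨p, hp⟩).2)
  have off : ∀ w : StripSum A.S, (∀ I : HalfEdge A.S, A.ξ I ≠ I → w ∉ I.toSet) →
      w ∈ (⋃ γ, (A.X γ).toSet ∪ (A.Y γ).toSet)ᶜ := by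
    intro w hw hm
    obtain ⟨γ, h | h⟩ := mem_iUnion.1 hm
    · exact hw _ (fun h => (ξ_eq_of_fixed h).1 γ rfl) h
    · exact hw _ (fun h => (ξ_eq_of_fixed h).2 γ rfl) h
  by_cases h1 : ∃ I : HalfEdge A.S, A.ξ I ≠ I ∧ p ∈ I.toSet
  · obtain ⟨I, hI, hp⟩ := h1
    exact (key p p' h I hI hp).imp id fun h' => ⟨I, hI, hp, h'⟩
  by_cases h2 : ∃ I : HalfEdge A.S, A.ξ I ≠ I ∧ p' ∈ I.toSet
  · obtain ⟨I, hI, hp'⟩ := h2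
    refine (key p' p h.symm I hI hp').imp Eq.symm fun h' => ⟨A.ξ I, A.ξ_ne hI, h', ?_⟩
    rwa [A.ξ_involutive]
  · push Not at h1 h2
    exact Or.inl (A.injOn (off p h1) (off p' h2) h)

end StripedAtlas

/-! ### Foliated homeomorphisms of disjoint unions of strips -/

namespace HalfEdge

variable {Λ : Type*} {S : Λ → Strip}

theorem toSet_injective : Function.Injective (toSet : HalfEdge S → Set (StripSum S)) := by
  intro X Y h
  obtain ⟨p, hp⟩ := X.toSet_nonempty
  exact eq_of_mem_toSet hp (h ▸ hp)

end HalfEdge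

section Leaves

variable {Λ : Type*} {S : Λ → Strip}

theorem exists_mem_stripLeaves (p : StripSum S) : ∃ ω ∈ stripLeaves S, p ∈ ω := by
  by_cases h : p.IsInterior
  · exact ⟨_, Or.inl ⟨p.1, p.y, h, rfl⟩, rfl, rfl⟩
  · obtain ⟨X, hX⟩ := HalfEdge.exists_mem_toSet h
    exact ⟨_, Or.inr ⟨X, rfl⟩, hX⟩

theorem nonempty_of_mem_stripLeaves {ω : Set (StripSum S)} (h : ω ∈ stripLeaves S) :
    ω.Nonempty := by
  rcases h with ⟨l, t, ht, rfl⟩ | ⟨X, rfl⟩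
  · exact ⟨StripSum.mk S l (0, t), StripSum.mk_fst _ _,
      StripSum.mk_y ((S l).mem_carrier_of_mem_Ioo ht)⟩
  · exact X.toSet_nonempty

theorem eq_of_mem_stripLeaves {ω ω' : Set (StripSum S)} (h : ω ∈ stripLeaves S)
    (h' : ω' ∈ stripLeaves S) {p : StripSum S} (hp : p ∈ ω) (hp' : p ∈ ω') : ω = ω' := by
  rcases h with ⟨l, t, ht, rfl⟩ | ⟨X, rfl⟩ <;> rcases h' with ⟨l', t', ht', rfl⟩ | ⟨X', rfl⟩
  · rw [← hp.1, ← hp.2, ← hp'.1, ← hp'.2]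
  · refine absurd ?_ (HalfEdge.not_isInterior hp')
    obtain ⟨rfl, rfl⟩ := hp
    exact ht
  · refine absurd ?_ (HalfEdge.not_isInterior hp)
    obtain ⟨rfl, rfl⟩ := hp'
    exact ht'
  · rw [HalfEdge.eq_of_mem_toSet hp hp']

/-- A set between a strip and its interior is connected. -/
theorem isPreconnected_of_interior_subset {l : Λ} {B : Set (StripSum S)}
    (h1 : ∀ p : StripSum S, p.1 = l → p.IsInterior → p ∈ B) (h2 : ∀ p ∈ B, p.1 = l) :
    IsPreconnected B := by
  have hV : IsPreconnected ((univ : Set ℝ) ×ˢ Ioo (S l).u (S l).v) :=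
    isPreconnected_univ.prod isPreconnected_Ioo
  refine (hV.image (StripSum.mk S l)
    ((StripSum.continuousOn_mk l).mono (S l).open_subset)).subset_closure ?_ fun p hp => ?_
  · rintro _ ⟨z, hz, rfl⟩
    exact h1 _ (StripSum.mk_fst _ _) (StripSum.isInterior_mk hz.2)
  · have hl := h2 p hp
    have := StripSum.neBot_nhdsWithin (hl ▸ p.y_mem_Icc)
    refine mem_closure_of_tendsto (StripSum.tendsto_mk hl) ?_
    filter_upwards [self_mem_nhdsWithin] with t ht
    exact ⟨_, ⟨mem_univ _, ht⟩, rfl⟩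

end Leaves

section Foliated

variable {Λ Λ' : Type*} {S : Λ → Strip} {S' : Λ' → Strip}

theorem fst_eq_of_continuous {h : StripSum S → StripSum S'} (hc : Continuous h)
    {p p' : StripSum S} (hp : p.1 = p'.1) : (h p).1 = (h p').1 := by
  have h1 : IsPreconnected {w : StripSum S | w.1 = p'.1} :=
    isPreconnected_of_interior_subset (l := p'.1) (fun _ h _ => h) fun _ h => h
  have h2 : IsClopen {w : StripSum S' | w.1 = (h p').1} := by
    have : {w : StripSum S' | w.1 = (h p').1} =
        range (Sigma.mk (β := fun l => (S' l).carrier) (h p').1) := by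
      ext ⟨l, w⟩
      constructor
      · rintro rfl
        exact ⟨w, rfl⟩
      · rintro ⟨w', hw'⟩
        exact (congrArg Sigma.fst hw').symm
    rw [this]
    exact isClopen_range_sigmaMk
  exact h1.subset_isClopen (h2.preimage hc) ⟨p', rfl, rfl⟩ hp

theorem exists_vertexEquiv (h : StripSum S ≃ₜ StripSum S') :
    ∃ ν : Λ ≃ Λ', ∀ p, (h p).1 = ν p.1 := by
  let f : Λ → Λ' := fun l => (h (StripSum.mk S l (0, 0))).1
  let g : Λ' → Λ := fun l => (h.symm (StripSum.mk S' l (0, 0))).1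
  have hf : ∀ p, (h p).1 = f p.1 := fun p =>
    fst_eq_of_continuous h.continuous (StripSum.mk_fst _ _).symm
  have hg : ∀ p, (h.symm p).1 = g p.1 := fun p =>
    fst_eq_of_continuous h.symm.continuous (StripSum.mk_fst _ _).symm
  refine ⟨⟨f, g, fun l => ?_, fun l => ?_⟩, hf⟩
  · rw [← hg, h.symm_apply_apply, StripSum.mk_fst]
  · rw [← hf, h.apply_symm_apply, StripSum.mk_fst]

namespace IsFoliated

variable {h : StripSum S ≃ₜ StripSum S'}

theorem symm (hF : IsFoliated (stripLeaves S) (stripLeaves S') h) :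
    IsFoliated (stripLeaves S') (stripLeaves S) h.symm := by
  intro ω' hω'
  obtain ⟨p', hp'⟩ := nonempty_of_mem_stripLeaves hω'
  obtain ⟨ω, hω, hp⟩ := exists_mem_stripLeaves (h.symm p')
  have : h '' ω = ω' := eq_of_mem_stripLeaves (hF ω hω) hω' ⟨_, hp, h.apply_symm_apply p'⟩ hp'
  rw [← this, ← image_comp, h.symm_comp_self, image_id]
  exact hω

/-- Interior points are mapped to interior points, since an interior leaf separates its strip
and a boundary interval does not. -/
theorem isInterior (hF : IsFoliated (stripLeaves S) (stripLeaves S') h) {p : StripSum S}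
    (hp : p.IsInterior) : (h p).IsInterior := by
  rcases hF {w | w.1 = p.1 ∧ w.y = p.y} (Or.inl ⟨p.1, p.y, hp, rfl⟩) with
    ⟨l', t', ht', heq⟩ | ⟨X, heq⟩
  · have : h p ∈ {w : StripSum S' | w.1 = l' ∧ w.y = t'} := heq ▸ mem_image_of_mem h ⟨rfl, rfl⟩
    obtain ⟨rfl, rfl⟩ := this
    exact ht'
  · exfalso
    have hpX : h p ∈ X.toSet := heq ▸ mem_image_of_mem h ⟨rfl, rfl⟩
    let B : Set (StripSum S') := {w | w.1 = X.vertex} \ X.toSet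
    have hB : IsPreconnected B := isPreconnected_of_interior_subset (l := X.vertex)
      (fun w h1 h2 => ⟨h1, fun h3 => HalfEdge.not_isInterior h3 h2⟩) fun w hw => hw.1
    have hB' : IsPreconnected (h ⁻¹' B) := by
      rw [← h.image_symm]; exact hB.image _ h.symm.continuous.continuousOn
    have hmem : ∀ w : StripSum S, w.1 = p.1 → w.y ≠ p.y → w ∈ h ⁻¹' B := fun w h1 h2 => by
      refine ⟨(fst_eq_of_continuous h.continuous h1).trans hpX.1, fun h3 => h2 ?_⟩
      rw [← heq] at h3
      exact ((h.injective.mem_set_image).1 h3).2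
    obtain ⟨t₁, ht₁, ht₁'⟩ := exists_between hp.1
    obtain ⟨t₂, ht₂, ht₂'⟩ := exists_between hp.2
    have hc₁ : ((0 : ℝ), t₁) ∈ (S p.1).carrier :=
      (S p.1).mem_carrier_of_mem_Ioo ⟨ht₁, ht₁'.trans hp.2⟩
    have hc₂ : ((0 : ℝ), t₂) ∈ (S p.1).carrier :=
      (S p.1).mem_carrier_of_mem_Ioo ⟨hp.1.trans ht₂, ht₂'⟩
    have h1 := hmem (StripSum.mk S p.1 (0, t₁)) (StripSum.mk_fst _ _)
      (by rw [StripSum.mk_y hc₁]; exact ht₁'.ne)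
    have h2 := hmem (StripSum.mk S p.1 (0, t₂)) (StripSum.mk_fst _ _)
      (by rw [StripSum.mk_y hc₂]; exact ht₂.ne')
    obtain ⟨w, hw, hwy⟩ := hB'.intermediate_value h1 h2 StripSum.continuous_y.continuousOn
      (show p.y ∈ Icc _ _ by rw [StripSum.mk_y hc₁, StripSum.mk_y hc₂]; exact ⟨ht₁'.le, ht₂.le⟩)
    have hw1 : w.1 = p.1 := by
      have := fst_eq_of_continuous h.symm.continuous (hw.1.trans hpX.1.symm)
      rwa [h.symm_apply_apply, h.symm_apply_apply] at this
    exact hw.2 (heq ▸ mem_image_of_mem h ⟨hw1, hwy⟩)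

/-- Interior leaves are mapped into leaves, and a leaf has a single height. -/
theorem y_eq_of_isInterior (hF : IsFoliated (stripLeaves S) (stripLeaves S') h)
    {p p' : StripSum S} (hp : p.IsInterior) (h1 : p.1 = p'.1) (h2 : p.y = p'.y) :
    (h p).y = (h p').y := by
  have hω := hF {w | w.1 = p.1 ∧ w.y = p.y} (Or.inl ⟨p.1, p.y, hp, rfl⟩)
  have hm : h p ∈ h '' {w | w.1 = p.1 ∧ w.y = p.y} := mem_image_of_mem h ⟨rfl, rfl⟩
  have hm' : h p' ∈ h '' {w | w.1 = p.1 ∧ w.y = p.y} := mem_image_of_mem h ⟨h1.symm, h2.symm⟩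
  rcases hω with ⟨l', t', ht', heq⟩ | ⟨X, heq⟩ <;> rw [heq] at hm hm'
  · rw [hm.2, hm'.2]
  · rw [hm.2.2, hm'.2.2]

/-- Points at the same height are mapped to points at the same height. On the boundary, where a
side may consist of several leaves, this is a limit of the statement for interior leaves. -/
theorem y_eq (hF : IsFoliated (stripLeaves S) (stripLeaves S') h) {p p' : StripSum S}
    (h1 : p.1 = p'.1) (h2 : p.y = p'.y) : (h p).y = (h p').y := by
  have := StripSum.neBot_nhdsWithin p.y_mem_Icc
  have hy : Continuous fun w => (h w).y := StripSum.continuous_y.comp h.continuous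
  have ht := (hy.tendsto p).comp (StripSum.tendsto_mk (p := p) rfl)
  have ht' := (hy.tendsto p').comp (StripSum.tendsto_mk (p := p') h1.symm)
  rw [← h2] at ht'
  refine tendsto_nhds_unique_of_eventuallyEq ht ht' ?_
  filter_upwards [self_mem_nhdsWithin] with t hI
  have hc := fun a : ℝ => (S p.1).mem_carrier_of_mem_Ioo (z := (a, t)) hI
  exact hF.y_eq_of_isInterior (StripSum.isInterior_mk hI)
    ((StripSum.mk_fst _ _).trans (StripSum.mk_fst _ _).symm)
    (by rw [StripSum.mk_y (hc _), StripSum.mk_y (hc _)])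

/-- A foliated homeomorphism has a constant vertical direction on each strip. -/
theorem exists_vertical_sign (hF : IsFoliated (stripLeaves S) (stripLeaves S') h) (l : Λ) :
    ∃ e : ℤˣ, ∀ p p' : StripSum S, p.1 = l → p'.1 = l → p.IsInterior → p'.IsInterior →
      p.y < p'.y → Signed e (· < ·) (h p).y (h p').y := by
  have hc := fun {t : ℝ} (ht : t ∈ Ioo (S l).u (S l).v) =>
    (S l).mem_carrier_of_mem_Ioo (z := (0, t)) ht
  have hcont : ContinuousOn (fun t : ℝ => (h (StripSum.mk S l (0, t))).y)
      (Ioo (S l).u (S l).v) :=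
    (StripSum.continuous_y.comp h.continuous).comp_continuousOn
      ((StripSum.continuousOn_mk l).comp (by fun_prop) fun t ht => hc ht)
  have hP := (ordConnected_Ioo (a := (S l).u) (b := (S l).v)).isPreconnected_pairs
  obtain ⟨e, he⟩ := hP.exists_sign
    (f := fun z => (h (StripSum.mk S l (0, z.1))).y)
    (g := fun z => (h (StripSum.mk S l (0, z.2))).y)
    (hcont.comp continuousOn_fst fun z hz => hz.1.1)
    (hcont.comp continuousOn_snd fun z hz => hz.1.2) fun z hz heq => by
      have h1 := hF.symm.y_eq_of_isInterior (hF.isInterior (StripSum.isInterior_mk hz.1.1))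
        (fst_eq_of_continuous h.continuous ((StripSum.mk_fst _ _).trans (StripSum.mk_fst _ _).symm))
        heq
      rw [h.symm_apply_apply, h.symm_apply_apply, StripSum.mk_y (hc hz.1.1),
        StripSum.mk_y (hc hz.1.2)] at h1
      exact hz.2.ne h1
  refine ⟨e, fun p p' hp hp' hi hi' hlt => ?_⟩
  have h1 := he (p.y, p'.y) ⟨⟨hi.mem hp, hi'.mem hp'⟩, hlt⟩
  have key : ∀ w : StripSum S, w.1 = l → w.IsInterior →
      (h (StripSum.mk S l (0, w.y))).y = (h w).y := fun w hw hwi =>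
    hF.y_eq_of_isInterior (StripSum.isInterior_mk (hwi.mem hw))
      ((StripSum.mk_fst _ _).trans hw.symm)
      (StripSum.mk_y (hc (hwi.mem hw)))
  simp only [key p hp hi, key p' hp' hi'] at h1
  exact h1

/-- A foliated homeomorphism has a constant horizontal direction on each strip. On the boundary
intervals this follows from the interior by taking limits along vertical lines. -/
theorem exists_horizontal_sign (hF : IsFoliated (stripLeaves S) (stripLeaves S') h) (l : Λ) :
    ∃ e : ℤˣ, ∀ p p' : StripSum S, p.1 = l → p'.1 = l → p.y = p'.y → p.x < p'.x →
      Signed e (· < ·) (h p).x (h p').x := by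
  have hc := fun {a t : ℝ} (ht : t ∈ Ioo (S l).u (S l).v) =>
    (S l).mem_carrier_of_mem_Ioo (z := (a, t)) ht
  have hcont : ContinuousOn (fun z : ℝ × ℝ => (h (StripSum.mk S l z)).x)
      (univ ×ˢ Ioo (S l).u (S l).v) :=
    (StripSum.continuous_x.comp h.continuous).comp_continuousOn
      ((StripSum.continuousOn_mk l).mono (S l).open_subset)
  have hne : ∀ p p' : StripSum S, p.1 = p'.1 → p.y = p'.y → p.x < p'.x →
      (h p).x ≠ (h p').x := fun p p' h1 h2 h3 heq => by
    have := h.injective (StripSum.ext_coord (fst_eq_of_continuous h.continuous h1) heq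
      (hF.y_eq h1 h2))
    exact h3.ne (congrArg StripSum.x this)
  let P : Set ((ℝ × ℝ) × ℝ) :=
    {z | (z.1 ∈ (univ : Set ℝ) ∧ z.2 ∈ (univ : Set ℝ)) ∧ z.1 < z.2} ×ˢ Ioo (S l).u (S l).v
  have hP : IsPreconnected P := ordConnected_univ.isPreconnected_pairs.prod isPreconnected_Ioo
  have hf : ContinuousOn (fun z : (ℝ × ℝ) × ℝ => (h (StripSum.mk S l (z.1.1, z.2))).x) P :=
    hcont.comp (t := univ ×ˢ Ioo (S l).u (S l).v) (f := fun z : (ℝ × ℝ) × ℝ => (z.1.1, z.2))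
      (by fun_prop) fun z hz => ⟨mem_univ _, hz.2⟩
  have hg : ContinuousOn (fun z : (ℝ × ℝ) × ℝ => (h (StripSum.mk S l (z.1.2, z.2))).x) P :=
    hcont.comp (t := univ ×ˢ Ioo (S l).u (S l).v) (f := fun z : (ℝ × ℝ) × ℝ => (z.1.2, z.2))
      (by fun_prop) fun z hz => ⟨mem_univ _, hz.2⟩
  obtain ⟨e, he⟩ := hP.exists_sign hf hg fun z hz => by
    refine hne _ _ ((StripSum.mk_fst _ _).trans (StripSum.mk_fst _ _).symm) ?_ ?_
    · rw [StripSum.mk_y (hc hz.2), StripSum.mk_y (hc hz.2)]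
    · rw [StripSum.mk_x (hc hz.2), StripSum.mk_x (hc hz.2)]
      exact hz.1.2
  refine ⟨e, fun p p' hp hp' hy hlt => ?_⟩
  have hx : Continuous fun w => (h w).x := StripSum.continuous_x.comp h.continuous
  have := StripSum.neBot_nhdsWithin (hp ▸ p.y_mem_Icc)
  have ht := ((hx.tendsto p).comp (StripSum.tendsto_mk hp)).const_mul ((e : ℤ) : ℝ)
  have ht' := ((hx.tendsto p').comp (StripSum.tendsto_mk hp')).const_mul ((e : ℤ) : ℝ)
  rw [← hy] at ht'
  refine signed_lt_iff.2 (lt_of_le_of_ne (le_of_tendsto_of_tendsto ht ht' ?_) fun heq => ?_)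
  · filter_upwards [self_mem_nhdsWithin] with t hI
    exact (signed_lt_iff.1 (he ((p.x, p'.x), t) ⟨⟨⟨mem_univ _, mem_univ _⟩, hlt⟩, hI⟩)).le
  · exact hne p p' (hp.trans hp'.symm) hy hlt (mul_left_cancel₀ (by simp) heq)

theorem exists_image_eq (hF : IsFoliated (stripLeaves S) (stripLeaves S') h) (X : HalfEdge S) :
    ∃ Y : HalfEdge S', h '' X.toSet = Y.toSet := by
  rcases hF X.toSet (Or.inr ⟨X, rfl⟩) with ⟨l', t', ht', heq⟩ | ⟨Y, heq⟩
  · exfalso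
    obtain ⟨p, hp⟩ := X.toSet_nonempty
    obtain ⟨rfl, rfl⟩ : h p ∈ {w : StripSum S' | w.1 = l' ∧ w.y = t'} :=
      heq ▸ mem_image_of_mem h hp
    have := hF.symm.isInterior (p := h p) ht'
    rw [h.symm_apply_apply] at this
    exact HalfEdge.not_isInterior hp this
  · exact ⟨Y, heq⟩

theorem exists_halfEdgeEquiv (hF : IsFoliated (stripLeaves S) (stripLeaves S') h) :
    ∃ η : HalfEdge S ≃ HalfEdge S', ∀ X, h '' X.toSet = (η X).toSet := by
  choose f hf using hF.exists_image_eq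
  choose g hg using hF.symm.exists_image_eq
  refine ⟨⟨f, g, fun X => HalfEdge.toSet_injective ?_, fun X => HalfEdge.toSet_injective ?_⟩, hf⟩
  · rw [← hg, ← hf, ← image_comp, h.symm_comp_self, image_id]
  · rw [← hf, ← hg, ← image_comp, h.self_comp_symm, image_id]

/-- The vertical direction `e` on a strip determines the side to which a boundary interval is
mapped: the heights of the image of a vertical line that tends to it move in the direction
`e * X.side`. -/
theorem side_eq (hF : IsFoliated (stripLeaves S) (stripLeaves S') h) {X : HalfEdge S}
    {Y : HalfEdge S'} (hXY : h '' X.toSet = Y.toSet) {e : ℤˣ}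
    (he : ∀ p p' : StripSum S, p.1 = X.vertex → p'.1 = X.vertex → p.IsInterior →
      p'.IsInterior → p.y < p'.y → Signed e (· < ·) (h p).y (h p').y) :
    Y.side = e * X.side := by
  obtain ⟨p, hp⟩ := X.toSet_nonempty
  have hq : h p ∈ Y.toSet := hXY ▸ mem_image_of_mem h hp
  let T := Ioo (S X.vertex).u (S X.vertex).v
  let m : ℝ → StripSum S := fun t => StripSum.mk S X.vertex (p.x, t)
  have hm : ∀ t, (m t).1 = X.vertex := fun t => StripSum.mk_fst _ _
  have hi : ∀ t ∈ T, (m t).IsInterior := fun t ht => StripSum.isInterior_mk ht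
  have hmono : ∀ a ∈ T, ∀ b ∈ T, a < b → Signed e (· < ·) (h (m a)).y (h (m b)).y := by
    intro a ha b hb hab
    refine he _ _ (hm a) (hm b) (hi a ha) (hi b hb) ?_
    rw [StripSum.mk_y ((S X.vertex).mem_carrier_of_mem_Ioo ha),
      StripSum.mk_y ((S X.vertex).mem_carrier_of_mem_Ioo hb)]
    exact hab
  obtain ⟨t₀, ht₀⟩ : T.Nonempty := nonempty_Ioo.2 (S X.vertex).u_lt_v
  have hpy : p.y ∈ Icc (S X.vertex).u (S X.vertex).v := hp.1 ▸ p.y_mem_Icc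
  -- An interior height strictly between `t₀` and the boundary level.
  obtain ⟨t₁, ht₁, h01, h1p⟩ : ∃ t₁ ∈ T, Signed X.side (· < ·) t₀ t₁ ∧
      Signed X.side (· < ·) t₁ p.y := by
    rcases Int.units_eq_one_or X.side with hs | hs
    · have h1 : p.y = (S X.vertex).v := by rw [hp.2.2, hs, Strip.level_one]
      obtain ⟨t₁, h2, h3⟩ := exists_between ht₀.2
      exact ⟨t₁, ⟨ht₀.1.trans h2, h3⟩, by rw [hs]; exact signed_one.2 h2,
        by rw [hs, h1]; exact signed_one.2 h3⟩
    · have h1 : p.y = (S X.vertex).u := by rw [hp.2.2, hs, Strip.level_neg_one]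
      obtain ⟨t₁, h2, h3⟩ := exists_between ht₀.1
      exact ⟨t₁, ⟨h2, h3.trans ht₀.2⟩, by rw [hs]; exact signed_neg_one.2 h3,
        by rw [hs, h1]; exact signed_neg_one.2 h2⟩
  have hy : Continuous fun w => (h w).y := StripSum.continuous_y.comp h.continuous
  have := StripSum.neBot_nhdsWithin hpy
  have ht := ((hy.tendsto p).comp (StripSum.tendsto_mk hp.1)).const_mul
    (((e * X.side : ℤˣ) : ℤ) : ℝ)
  have hev : ∀ᶠ t in 𝓝 p.y, Signed X.side (· < ·) t₁ t := by
    have hcont : Continuous fun t : ℝ => ((X.side : ℤ) : ℝ) * t := by fun_prop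
    simp only [signed_lt_iff] at h1p ⊢
    exact (hcont.tendsto p.y).eventually_const_lt h1p
  have hle := ge_of_tendsto (b := (((e * X.side : ℤˣ) : ℤ) : ℝ) * (h (m t₁)).y) ht (by
    filter_upwards [self_mem_nhdsWithin, hev.filter_mono nhdsWithin_le_nhds] with t hI hlt
    exact (signed_lt_iff.1 (Signed.map hmono ht₁ hI hlt)).le)
  have h1 : Signed (e * X.side) (· < ·) (h (m t₀)).y (h p).y :=
    signed_lt_iff.2 ((signed_lt_iff.1 (Signed.map hmono ht₀ ht₁ h01)).trans_le hle)
  have hv : (h (m t₀)).1 = Y.vertex :=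
    (fst_eq_of_continuous h.continuous ((hm t₀).trans hp.1.symm)).trans hq.1
  rw [hq.2.2] at h1
  exact ((S' Y.vertex).signed_level Y.side ((hF.isInterior (hi t₀ ht₀)).mem hv)).sign_unique h1

end IsFoliated

end Foliated

/-! ### The isomorphism of graphs induced by an equivalence -/

namespace StripedAtlas

variable {Λ Γ Z Λ' Γ' Z' : Type*} [TopologicalSpace Z] [TopologicalSpace Z']
  {A : StripedAtlas Λ Γ Z} {A' : StripedAtlas Λ' Γ' Z'}

/-- The orientation of gluing compares the horizontal order of two points of a boundary interval
with that of the points glued to them. -/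
theorem signed_σ {I : HalfEdge A.S} (hI : A.ξ I ≠ I) {p p' r r' : StripSum A.S}
    (hp : p ∈ I.toSet) (hp' : p' ∈ I.toSet) (hr : r ∈ (A.ξ I).toSet) (hr' : r' ∈ (A.ξ I).toSet)
    (h : A.q p = A.q r) (h' : A.q p' = A.q r') (hlt : p.x < p'.x) :
    Signed (A.σ ⟨I, hI⟩) (· < ·) r.x r'.x := by
  obtain ⟨e, he, hs⟩ := exists_homeomorph_glued hI
  have key : ∀ (p r : StripSum A.S) (hp : p ∈ I.toSet), r ∈ (A.ξ I).toSet → A.q p = A.q r →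
      (e ⟨p, hp⟩).1 = r := fun p r hp hr h =>
    injOn_glued (A.ξ_ne hI) (e ⟨p, hp⟩).2 hr ((he _).trans h)
  have := hs ⟨p, hp⟩ ⟨p', hp'⟩ hlt
  rwa [key p r hp hr h, key p' r' hp' hr' h'] at this

theorem exists_glued_point {I : HalfEdge A.S} (hI : A.ξ I ≠ I) {p : StripSum A.S}
    (hp : p ∈ I.toSet) : ∃ r ∈ (A.ξ I).toSet, A.q p = A.q r := by
  obtain ⟨e, he, -⟩ := exists_homeomorph_glued hI
  exact ⟨(e ⟨p, hp⟩).1, (e ⟨p, hp⟩).2, (he ⟨p, hp⟩).symm⟩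

/-- A boundary interval that shares a point of `Z` with a glued boundary interval is its
partner. -/
theorem ξ_eq_of_glued [ChartedSpace (EuclideanHalfSpace 2) Z] {I J : HalfEdge A.S}
    {p r : StripSum A.S} (hp : p ∈ I.toSet) (hr : r ∈ J.toSet) (hpr : p ≠ r)
    (h : A.q p = A.q r) : A.ξ I = J := by
  rcases eq_or_exists_glued h with h' | ⟨K, -, h1, h2⟩
  · exact absurd h' hpr
  · rw [HalfEdge.eq_of_mem_toSet hp h1, HalfEdge.eq_of_mem_toSet h2 hr]

/-- An equivalence respects the gluing involution, because `k ∘ q = q' ∘ h` and the fibres of `q`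
and `q'` determine which boundary intervals are glued. -/
theorem Equivalence.ξ_comm [ChartedSpace (EuclideanHalfSpace 2) Z]
    [ChartedSpace (EuclideanHalfSpace 2) Z'] (E : A.Equivalence A')
    {η : HalfEdge A.S ≃ HalfEdge A'.S} (hη : ∀ X, E.h '' X.toSet = (η X).toSet)
    (X : HalfEdge A.S) : A'.ξ (η X) = η (A.ξ X) := by
  have hm : ∀ {X : HalfEdge A.S} {p}, p ∈ X.toSet → E.h p ∈ (η X).toSet := fun {X p} hp =>
    hη X ▸ mem_image_of_mem E.h hp
  obtain ⟨p, hp⟩ := X.toSet_nonempty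
  by_cases hX : A.ξ X = X
  · rw [hX]
    by_contra hX'
    obtain ⟨r', hr', hq'⟩ := exists_glued_point hX' (hm hp)
    have hne : E.h p ≠ r' := fun h => hX' (HalfEdge.eq_of_mem_toSet (hm hp) (h ▸ hr')).symm
    obtain ⟨r, rfl⟩ := E.h.surjective r'
    rw [← E.comm, ← E.comm] at hq'
    rcases eq_or_exists_glued (E.k.injective hq') with h | ⟨K, hK, h1, -⟩
    · exact hne (congrArg E.h h)
    · exact hK (HalfEdge.eq_of_mem_toSet h1 hp ▸ hX)
  · obtain ⟨r, hr, hq⟩ := exists_glued_point hX hp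
    refine ξ_eq_of_glued (hm hp) (hm hr) (fun h => hX ?_) ?_
    · exact (HalfEdge.eq_of_mem_toSet hp (E.h.injective h ▸ hr)).symm
    · rw [← E.comm, ← E.comm, hq]

theorem Equivalence.exists_induces [ChartedSpace (EuclideanHalfSpace 2) Z]
    [ChartedSpace (EuclideanHalfSpace 2) Z'] (E : A.Equivalence A') :
    ∃ f : A.graph.Iso A'.graph, E.Induces f := by
  have hF := E.h_foliated
  obtain ⟨ν, hν⟩ := exists_vertexEquiv E.h
  obtain ⟨η, hη⟩ := hF.exists_halfEdgeEquiv
  choose ε hε using hF.exists_horizontal_sign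
  choose τ hτ using hF.exists_vertical_sign
  have hm : ∀ {X : HalfEdge A.S} {p}, p ∈ X.toSet → E.h p ∈ (η X).toSet := fun {X p} hp =>
    hη X ▸ mem_image_of_mem E.h hp
  have hvert : ∀ X, (η X).vertex = ν X.vertex := fun X => by
    obtain ⟨p, hp⟩ := X.toSet_nonempty
    rw [← (hm hp).1, hν, hp.1]
  have hside : ∀ X, (η X).side = τ X.vertex * X.side := fun X =>
    hF.side_eq (hη X) (hτ X.vertex)
  let f : A.graph.Iso A'.graph :=
    { ν := ν
      η := η
      ε := ε
      τ := τ
      image_d := by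
        intro l s
        ext Y
        constructor
        · rintro ⟨X, ⟨rfl, rfl⟩, rfl⟩
          exact ⟨hvert X, hside X⟩
        · rintro ⟨h1, h2⟩
          obtain ⟨X, rfl⟩ := η.surjective Y
          have hl : X.vertex = l := ν.injective ((hvert X).symm.trans h1)
          refine ⟨X, ⟨hl, ?_⟩, rfl⟩
          have h3 := (hside X).symm.trans h2
          rw [hl] at h3
          exact mul_left_cancel h3
      monotone := by
        rintro l s X ⟨rfl, rfl⟩ Y ⟨hl, hs⟩ hlt
        obtain ⟨p, hp⟩ := X.toSet_nonempty
        obtain ⟨r, hr⟩ := Y.toSet_nonempty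
        have hlt' : X.Lt Y := hlt
        have hne : η X ≠ η Y := fun h => HalfEdge.lt_irrefl X (η.injective h ▸ hlt')
        have hv' : (η X).vertex = (η Y).vertex := by rw [hvert, hvert, hlt'.1]
        have hs' : (η X).side = (η Y).side := by rw [hside, hside, hlt'.1, hlt'.2.1]
        have key : Signed (ε X.vertex) (· < ·) (E.h p).x (E.h r).x :=
          hε X.vertex p r hp.1 (hr.1.trans hlt'.1.symm)
            (by rw [hp.2.2, hr.2.2, hlt'.1, hlt'.2.1]) (hlt'.2.2 _ hp.2.1 _ hr.2.1)
        exact key.imp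
          (fun h => ⟨h.1, HalfEdge.lt_of_mem hv' hs' hne (hm hp).2.1 (hm hr).2.1 h.2⟩)
          fun h => ⟨h.1, HalfEdge.lt_of_mem hv'.symm hs'.symm hne.symm (hm hr).2.1 (hm hp).2.1 h.2⟩
      comm := E.ξ_comm hη
      compat := by
        intro X hX hX'
        -- Compare the images of two glued pairs of points: going through `ξ X` first and through
        -- `η X` first must give the same horizontal order on `ξ' (η X)`.
        obtain ⟨a, ha⟩ := X.interval_nonempty
        obtain ⟨b, hab, hb⟩ : ∃ b, a < b ∧ b ∈ X.interval := by
          have h1 : ∀ᶠ b in 𝓝[>] a, b ∈ X.interval :=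
            nhdsWithin_le_nhds (X.isOpen_interval.mem_nhds ha)
          obtain ⟨b, h2, h3⟩ := (h1.and self_mem_nhdsWithin).exists
          exact ⟨b, h3, h2⟩
        have hp := HalfEdge.pt_mem ha
        have hp' := HalfEdge.pt_mem hb
        have hlt : (X.pt a).x < (X.pt b).x := by rwa [HalfEdge.pt_x ha, HalfEdge.pt_x hb]
        obtain ⟨r, hr, hq⟩ := exists_glued_point (A := A) hX hp
        obtain ⟨r', hr', hq'⟩ := exists_glued_point (A := A) hX hp'
        have hcomm := E.ξ_comm hη X
        have hqE : A'.q (E.h (X.pt a)) = A'.q (E.h r) := by rw [← E.comm, ← E.comm, hq]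
        have hqE' : A'.q (E.h (X.pt b)) = A'.q (E.h r') := by rw [← E.comm, ← E.comm, hq']
        have hrE : E.h r ∈ (A'.ξ (η X)).toSet := hcomm ▸ hm hr
        have hrE' : E.h r' ∈ (A'.ξ (η X)).toSet := hcomm ▸ hm hr'
        have h1 : Signed (A.σ ⟨X, hX⟩) (· < ·) r.x r'.x := signed_σ hX hp hp' hr hr' hq hq' hlt
        have h2 : Signed (ε X.vertex) (· < ·) (E.h (X.pt a)).x (E.h (X.pt b)).x :=
          hε _ _ _ hp.1 hp'.1 (hp.2.2.trans hp'.2.2.symm) hlt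
        have h3 : Signed (ε (A.ξ X).vertex * A.σ ⟨X, hX⟩) (· < ·) (E.h r).x (E.h r').x :=
          h1.bind (hε _ _ _ hr.1 hr'.1 (hr.2.2.trans hr'.2.2.symm))
            (hε _ _ _ hr'.1 hr.1 (hr'.2.2.trans hr.2.2.symm))
        have h4 : Signed (A'.σ ⟨η X, hX'⟩ * ε X.vertex) (· < ·) (E.h r).x (E.h r').x :=
          h2.bind (signed_σ hX' (hm hp) (hm hp') hrE hrE' hqE hqE')
            (signed_σ hX' (hm hp') (hm hp) hrE' hrE hqE' hqE)
        have h5 := h3.sign_unique h4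
        have h6 : ∀ a b c d : ℤˣ, a * b = c * d → d * b = c * a := by decide
        exact h6 _ _ _ _ h5 }
  refine ⟨f, ⟨fun l => ?_, hη, fun p p' h _ _ hy hlt => hε _ p p' rfl h.symm hy hlt,
    fun p p' h hi hi' hlt => hτ _ p p' rfl h.symm hi hi' hlt⟩⟩
  ext w
  constructor
  · rintro ⟨p, rfl, rfl⟩
    exact hν p
  · intro hw
    obtain ⟨p, rfl⟩ := E.h.surjective w
    exact ⟨p, ν.injective ((hν p).symm.trans hw), rfl⟩

theorem Equivalence.Induces.unique {E : A.Equivalence A'} {f g : A.graph.Iso A'.graph}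
    (hf : E.Induces f) (hg : E.Induces g) : f = g := by
  have hfst : ∀ l, StripSum.mk A.S l (0, 0) ∈ {p : StripSum A.S | p.1 = l} := fun l =>
    StripSum.mk_fst _ _
  refine StripedGraph.Iso.ext (Equiv.ext fun l => ?_) (Equiv.ext fun X => ?_) (funext fun l => ?_)
    (funext fun l => ?_)
  · have h1 := hf.vertex l ▸ mem_image_of_mem E.h (hfst l)
    have h2 := hg.vertex l ▸ mem_image_of_mem E.h (hfst l)
    exact h1.symm.trans h2
  · exact HalfEdge.toSet_injective ((hf.halfEdge X).symm.trans (hg.halfEdge X))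
  · obtain ⟨t, ht⟩ := nonempty_Ioo.2 (A.S l).u_lt_v
    have hc := fun a : ℝ => (A.S l).mem_carrier_of_mem_Ioo (z := (a, t)) ht
    have key : ∀ k : A.graph.Iso A'.graph, E.Induces k → Signed (k.ε l) (· < ·)
        (E.h (StripSum.mk A.S l (0, t))).x (E.h (StripSum.mk A.S l (1, t))).x := fun k hk => by
      have := hk.horizontal (StripSum.mk A.S l (0, t)) (StripSum.mk A.S l (1, t))
        ((StripSum.mk_fst _ _).trans (StripSum.mk_fst _ _).symm) (StripSum.isInterior_mk ht)
        (StripSum.isInterior_mk ht) (by rw [StripSum.mk_y (hc _), StripSum.mk_y (hc _)])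
        (by rw [StripSum.mk_x (hc _), StripSum.mk_x (hc _)]; exact zero_lt_one)
      rwa [StripSum.mk_fst] at this
    exact (key f hf).sign_unique (key g hg)
  · obtain ⟨t, ht⟩ := nonempty_Ioo.2 (A.S l).u_lt_v
    obtain ⟨t', h1, h2⟩ := exists_between ht.2
    have ht' : t' ∈ Ioo (A.S l).u (A.S l).v := ⟨ht.1.trans h1, h2⟩
    have key : ∀ k : A.graph.Iso A'.graph, E.Induces k → Signed (k.τ l) (· < ·)
        (E.h (StripSum.mk A.S l (0, t))).y (E.h (StripSum.mk A.S l (0, t'))).y := fun k hk => by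
      have := hk.vertical (StripSum.mk A.S l (0, t)) (StripSum.mk A.S l (0, t'))
        ((StripSum.mk_fst _ _).trans (StripSum.mk_fst _ _).symm) (StripSum.isInterior_mk ht)
        (StripSum.isInterior_mk ht')
        (by rwa [StripSum.mk_y ((A.S l).mem_carrier_of_mem_Ioo ht),
          StripSum.mk_y ((A.S l).mem_carrier_of_mem_Ioo ht')])
      rwa [StripSum.mk_fst] at this
    exact (key f hf).sign_unique (key g hg)

end StripedAtlas

/-! ### Approximation of monotone functions by homeomorphisms of the line -/

/-- A monotone function `G` from `[-1, 1]` to itself is approximated by increasing homeomorphisms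
`F r` of `[-1, 1]` at its points of continuity. `F r` is a convex combination of the identity and
of a moving average of `G`, whose window of length `r` slides from `[-1 - r, -1]` for `x = -1` to
`[1, 1 + r]` for `x = 1`, so that the end points are fixed. -/
theorem Monotone.exists_smoothing {G : ℝ → ℝ} (hG : Monotone G) (hl : ∀ z ≤ -1, G z = -1)
    (hr : ∀ z, 1 ≤ z → G z = 1) :
    ∃ F : ℝ → ℝ → ℝ,
      (∀ r ∈ Ioo (0 : ℝ) 1, StrictMono (F r) ∧ Continuous (F r) ∧ F r (-1) = -1 ∧ F r 1 = 1) ∧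
      (∀ x, ContinuousOn (fun r => F r x) (Ioo 0 1)) ∧
      ∀ z ∈ Icc (-1 : ℝ) 1, ContinuousAt G z →
        Filter.Tendsto (fun r => F r z) (𝓝[Ioo 0 1] 0) (𝓝 (G z)) := by
  have hint : ∀ a b, IntervalIntegrable G MeasureTheory.volume a b := fun a b =>
    hG.intervalIntegrable
  let P : ℝ → ℝ := fun b => ∫ x in (0 : ℝ)..b, G x
  have hP : Continuous P := intervalIntegral.continuous_primitive hint 0
  let c : ℝ → ℝ → ℝ := fun r x => x + r * (1 + x) / 2
  let M : ℝ → ℝ → ℝ := fun r x => r⁻¹ * (P (c r x) - P (c r x - r))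
  have hM : ∀ r, 0 < r → ∀ x, M r x = ∫ s in (0 : ℝ)..1, G (c r x - r * s) := fun r h0 x => by
    rw [intervalIntegral.integral_comp_sub_mul _ h0.ne']
    simp only [M, P, mul_one, mul_zero, sub_zero, smul_eq_mul]
    rw [intervalIntegral.integral_interval_sub_left (hint _ _) (hint _ _)]
  have hint' : ∀ r x : ℝ, 0 < r → IntervalIntegrable (fun s => G (c r x - r * s))
      MeasureTheory.volume 0 1 := fun r x h0 =>
    (hG.comp_antitone fun s t hst => by
      linarith [mul_le_mul_of_nonneg_left hst h0.le]).intervalIntegrable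
  have hMmono : ∀ r, 0 < r → Monotone (M r) := fun r h0 x y hxy => by
    rw [hM r h0, hM r h0]
    refine intervalIntegral.integral_mono_on zero_le_one (hint' r x h0) (hint' r y h0)
      fun s _ => hG ?_
    simp only [c]
    nlinarith
  have hconst : ∀ r, 0 < r → ∀ x k, (∀ s ∈ Icc (0 : ℝ) 1, G (c r x - r * s) = k) → M r x = k := by
    intro r h0 x k h
    rw [hM r h0, intervalIntegral.integral_congr (g := fun _ => k)]
    · simp
    · intro s hs
      rw [uIcc_of_le zero_le_one] at hs
      exact h s hs
  refine ⟨fun r x => (1 - r) * M r x + r * x, fun r h => ⟨?_, ?_, ?_, ?_⟩, fun x => ?_,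
    fun z hz hc => ?_⟩
  · intro x y hxy
    have h1 := mul_le_mul_of_nonneg_left (hMmono r h.1 hxy.le) (sub_nonneg.2 h.2.le)
    have h2 := mul_lt_mul_of_pos_left hxy h.1
    simp only
    linarith
  · fun_prop
  · have := hconst r h.1 (-1) (-1) fun s hs => hl _ (by
      have := mul_nonneg h.1.le hs.1
      simp only [c]; linarith)
    simp only [this]; ring
  · have := hconst r h.1 1 1 fun s hs => hr _ (by
      have := mul_le_mul_of_nonneg_left hs.2 h.1.le
      simp only [c]; linarith)
    simp only [this]; ring
  · have h1 : ContinuousOn (fun r : ℝ => r⁻¹) (Ioo 0 1) :=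
      continuousOn_inv₀.mono fun r hr => hr.1.ne'
    fun_prop
  · have hMt : Filter.Tendsto (fun r => M r z) (𝓝[Ioo 0 1] 0) (𝓝 (G z)) := by
      have hlo : Filter.Tendsto (fun r => G (z - r)) (𝓝[Ioo 0 1] 0) (𝓝 (G z)) := by
        have : Filter.Tendsto (fun r : ℝ => z - r) (𝓝 0) (𝓝 z) := by
          simpa using (show Continuous fun r : ℝ => z - r by fun_prop).tendsto 0
        exact (hc.tendsto.comp this).mono_left nhdsWithin_le_nhds
      have hhi : Filter.Tendsto (fun r => G (z + r)) (𝓝[Ioo 0 1] 0) (𝓝 (G z)) := by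
        have : Filter.Tendsto (fun r : ℝ => z + r) (𝓝 0) (𝓝 z) := by
          simpa using (show Continuous fun r : ℝ => z + r by fun_prop).tendsto 0
        exact (hc.tendsto.comp this).mono_left nhdsWithin_le_nhds
      have hbd : ∀ r ∈ Ioo (0 : ℝ) 1, ∀ s ∈ Icc (0 : ℝ) 1,
          z - r ≤ c r z - r * s ∧ c r z - r * s ≤ z + r := fun r h s hs => by
        have h1 := mul_nonneg h.1.le hs.1
        have h2 := mul_le_mul_of_nonneg_left hs.2 h.1.le
        have h3 := mul_nonneg h.1.le (by linarith [hz.1] : (0 : ℝ) ≤ 1 + z)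
        have h4 := mul_nonneg h.1.le (by linarith [hz.2] : (0 : ℝ) ≤ 1 - z)
        simp only [c]
        constructor <;> linarith
      refine tendsto_of_tendsto_of_tendsto_of_le_of_le' hlo hhi ?_ ?_ <;>
        filter_upwards [self_mem_nhdsWithin] with r h
      · have := intervalIntegral.integral_mono_on zero_le_one intervalIntegrable_const
          (hint' r z h.1) fun s hs => hG (hbd r h s hs).1
        simpa [hM r h.1] using this
      · have := intervalIntegral.integral_mono_on zero_le_one (hint' r z h.1)
          intervalIntegrable_const fun s hs => hG (hbd r h s hs).2
        simpa [hM r h.1] using this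
    have h1 : Filter.Tendsto (fun r : ℝ => 1 - r) (𝓝[Ioo 0 1] 0) (𝓝 1) := by
      simpa using ((show Continuous fun r : ℝ => 1 - r by fun_prop).tendsto 0).mono_left
        nhdsWithin_le_nhds
    have h2 : Filter.Tendsto (fun r : ℝ => r * z) (𝓝[Ioo 0 1] 0) (𝓝 0) := by
      simpa using ((show Continuous fun r : ℝ => r * z by fun_prop).tendsto 0).mono_left
        nhdsWithin_le_nhds
    simpa using (h1.mul hMt).add h2

/-- The compression `c` of the line to `(-1, 1)`, and its inverse `d` (arbitrary elsewhere). -/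
theorem exists_compression : ∃ c d : ℝ → ℝ, StrictMono c ∧ Continuous c ∧
    (∀ x, c x ∈ Ioo (-1 : ℝ) 1) ∧ (∀ x, d (c x) = x) ∧ (∀ z ∈ Ioo (-1 : ℝ) 1, c (d z) = z) ∧
    ContinuousOn d (Ioo (-1) 1) := by
  classical
  let o := orderIsoIooNegOneOne ℝ
  let d : ℝ → ℝ := fun z => if h : z ∈ Ioo (-1 : ℝ) 1 then o.symm ⟨z, h⟩ else 0
  refine ⟨fun x => o x, d, fun x y h => o.strictMono h,
    continuous_subtype_val.comp o.continuous, fun x => (o x).2, fun x => ?_, fun z hz => ?_, ?_⟩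
  · simp only [d]
    rw [dif_pos (o x).2]
    exact o.symm_apply_apply x
  · simp only [d]
    rw [dif_pos hz, o.apply_symm_apply]
  · rw [continuousOn_iff_continuous_domRestrict]
    have : (Ioo (-1 : ℝ) 1).domRestrict d = fun z => o.symm z := by
      ext1 z
      simp only [d, domRestrict_apply]
      rw [dif_pos z.2]
    rw [this]
    exact o.symm.continuous

/-- A strictly increasing function on an open set extends, in compressed coordinates, to a
monotone function that is constant outside `(-1, 1)`. -/
theorem StrictMonoOn.exists_compressed_extension {c d : ℝ → ℝ} (hc : StrictMono c)
    (hcc : Continuous c) (hcm : ∀ x, c x ∈ Ioo (-1 : ℝ) 1) (hdc : ∀ x, d (c x) = x)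
    (hcd : ∀ z ∈ Ioo (-1 : ℝ) 1, c (d z) = z) (hd : ContinuousOn d (Ioo (-1) 1))
    {T : Set ℝ} (hT : IsOpen T) {g : ℝ → ℝ} (hg : StrictMonoOn g T) (hgc : ContinuousOn g T) :
    ∃ G : ℝ → ℝ, Monotone G ∧ (∀ z ≤ -1, G z = -1) ∧ (∀ z, 1 ≤ z → G z = 1) ∧
      ∀ x ∈ T, G (c x) = c (g x) ∧ ContinuousAt G (c x) := by
  classical
  let f : ℝ → ℝ := fun z => if z ≤ -1 then -1 else if 1 ≤ z then 1 else c (g (d z))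
  have hf : ∀ z ∈ Ioo (-1 : ℝ) 1, f z = c (g (d z)) := fun z hz => by
    simp only [f]; rw [if_neg hz.1.not_ge, if_neg hz.2.not_ge]
  have hfb : ∀ z, f z ∈ Icc (-1 : ℝ) 1 := fun z => by
    simp only [f]
    split_ifs
    · norm_num
    · norm_num
    · exact Ioo_subset_Icc_self (hcm _)
  have hfl : ∀ z ≤ -1, f z = -1 := fun z hz => if_pos hz
  have hfr : ∀ z, 1 ≤ z → f z = 1 := fun z hz => by
    simp only [f]; rw [if_neg (by linarith), if_pos hz]
  let s : Set ℝ := {z | z ≤ -1 ∨ 1 ≤ z ∨ d z ∈ T}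
  have hfm : MonotoneOn f s := by
    intro z hz w hw hzw
    by_cases h1 : z ≤ -1
    · rw [hfl z h1]; exact (hfb w).1
    by_cases h2 : 1 ≤ w
    · rw [hfr w h2]; exact (hfb z).2
    push Not at h1 h2
    have hz' : z ∈ Ioo (-1 : ℝ) 1 := ⟨h1, hzw.trans_lt h2⟩
    have hw' : w ∈ Ioo (-1 : ℝ) 1 := ⟨h1.trans_le hzw, h2⟩
    rw [hf z hz', hf w hw']
    have hzT : d z ∈ T := (hz.resolve_left h1.not_ge).resolve_left hz'.2.not_ge
    have hwT : d w ∈ T := (hw.resolve_left hw'.1.not_ge).resolve_left h2.not_ge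
    refine hc.monotone (hg.monotoneOn hzT hwT ?_)
    rw [← hc.le_iff_le, hcd z hz', hcd w hw']
    exact hzw
  obtain ⟨G, hG, hGf⟩ := hfm.exists_monotone_extension
    ⟨-1, by rintro _ ⟨z, -, rfl⟩; exact (hfb z).1⟩ ⟨1, by rintro _ ⟨z, -, rfl⟩; exact (hfb z).2⟩
  refine ⟨G, hG, fun z hz => ?_, fun z hz => ?_, fun x hx => ?_⟩
  · rw [← hGf (Or.inl hz), hfl z hz]
  · rw [← hGf (Or.inr (Or.inl hz)), hfr z hz]
  · have hval : ∀ z ∈ Ioo (-1 : ℝ) 1, d z ∈ T → G z = c (g (d z)) := fun z hz hzT => by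
      rw [← hGf (Or.inr (Or.inr hzT)), hf z hz]
    refine ⟨by rw [hval _ (hcm x) (by rwa [hdc]), hdc], ?_⟩
    have hdx : ContinuousAt d (c x) := hd.continuousAt (isOpen_Ioo.mem_nhds (hcm x))
    have hTx : T ∈ 𝓝 (d (c x)) := by rw [hdc]; exact hT.mem_nhds hx
    have hgx : ContinuousAt (fun z => c (g (d z))) (c x) :=
      hcc.continuousAt.comp ((hgc.continuousAt hTx).comp hdx)
    refine hgx.congr ?_
    filter_upwards [isOpen_Ioo.mem_nhds (hcm x), hdx.preimage_mem_nhds hTx] with z h1 h2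
    exact (hval z h1 h2).symm

/-- Two strictly increasing functions on open subsets of the line are joined by a family of
increasing homeomorphisms of the line. -/
theorem exists_isotopy {T₀ T₁ : Set ℝ} (hT₀ : IsOpen T₀) (hT₁ : IsOpen T₁) {g₀ g₁ : ℝ → ℝ}
    (hg₀ : StrictMonoOn g₀ T₀) (hg₁ : StrictMonoOn g₁ T₁) (hc₀ : ContinuousOn g₀ T₀)
    (hc₁ : ContinuousOn g₁ T₁) :
    ∃ a : ℝ → ℝ → ℝ, (∀ t ∈ Ioo (0 : ℝ) 1, StrictMono (a t) ∧ Function.Surjective (a t)) ∧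
      (∀ x, ContinuousOn (fun t => a t x) (Ioo 0 1)) ∧
      (∀ x ∈ T₀, Filter.Tendsto (fun t => a t x) (𝓝[Ioo 0 1] 0) (𝓝 (g₀ x))) ∧
      ∀ x ∈ T₁, Filter.Tendsto (fun t => a t x) (𝓝[Ioo 0 1] 1) (𝓝 (g₁ x)) := by
  obtain ⟨c, d, hc, hcc, hcm, hdc, hcd, hd⟩ := exists_compression
  obtain ⟨G₀, hG₀, hl₀, hr₀, hGc₀⟩ :=
    hg₀.exists_compressed_extension hc hcc hcm hdc hcd hd hT₀ hc₀
  obtain ⟨G₁, hG₁, hl₁, hr₁, hGc₁⟩ :=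
    hg₁.exists_compressed_extension hc hcc hcm hdc hcd hd hT₁ hc₁
  obtain ⟨F₀, hF₀, hFc₀, hFt₀⟩ := hG₀.exists_smoothing hl₀ hr₀
  obtain ⟨F₁, hF₁, hFc₁, hFt₁⟩ := hG₁.exists_smoothing hl₁ hr₁
  have hflip : ∀ t ∈ Ioo (0 : ℝ) 1, 1 - t ∈ Ioo (0 : ℝ) 1 := fun t ht =>
    ⟨by linarith [ht.2], by linarith [ht.1]⟩
  -- Interpolate between the approximations of `G₀` at parameter `t` and of `G₁` at `1 - t`.
  let B : ℝ → ℝ → ℝ := fun t z => (1 - t) * F₀ t z + t * F₁ (1 - t) z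
  have hB : ∀ t ∈ Ioo (0 : ℝ) 1, StrictMono (B t) := fun t ht x y hxy => by
    have h1 := mul_lt_mul_of_pos_left ((hF₀ t ht).1 hxy) (hflip t ht).1
    have h2 := mul_lt_mul_of_pos_left ((hF₁ _ (hflip t ht)).1 hxy) ht.1
    simp only [B]
    linarith
  have hBc : ∀ t ∈ Ioo (0 : ℝ) 1, Continuous (B t) := fun t ht => by
    have h1 := (hF₀ t ht).2.1
    have h2 := (hF₁ _ (hflip t ht)).2.1
    fun_prop
  have hBl : ∀ t ∈ Ioo (0 : ℝ) 1, B t (-1) = -1 := fun t ht => by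
    simp only [B, (hF₀ t ht).2.2.1, (hF₁ _ (hflip t ht)).2.2.1]; ring
  have hBr : ∀ t ∈ Ioo (0 : ℝ) 1, B t 1 = 1 := fun t ht => by
    simp only [B, (hF₀ t ht).2.2.2, (hF₁ _ (hflip t ht)).2.2.2]; ring
  have hBm : ∀ t ∈ Ioo (0 : ℝ) 1, ∀ z ∈ Ioo (-1 : ℝ) 1, B t z ∈ Ioo (-1 : ℝ) 1 :=
    fun t ht z hz => ⟨hBl t ht ▸ hB t ht hz.1, (hB t ht hz.2).trans_eq (hBr t ht)⟩
  have hBtime : ∀ z, ContinuousOn (fun t => B t z) (Ioo 0 1) := fun z => by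
    have h1 := hFc₀ z
    have h2 : ContinuousOn (fun t => F₁ (1 - t) z) (Ioo 0 1) :=
      (hFc₁ z).comp (f := fun t : ℝ => 1 - t) (by fun_prop) hflip
    exact ((continuousOn_const.sub continuousOn_id).mul h1).add (continuousOn_id.mul h2)
  -- At the ends of the time interval, one of the two terms vanishes in the limit.
  have hFb₀ : ∀ t ∈ Ioo (0 : ℝ) 1, ∀ z ∈ Ioo (-1 : ℝ) 1, |F₀ t z| ≤ 1 := fun t ht z hz =>
    abs_le.2 ⟨(hF₀ t ht).2.2.1 ▸ ((hF₀ t ht).1 hz.1).le,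
      ((hF₀ t ht).1 hz.2).le.trans_eq (hF₀ t ht).2.2.2⟩
  have hFb₁ : ∀ t ∈ Ioo (0 : ℝ) 1, ∀ z ∈ Ioo (-1 : ℝ) 1, |F₁ t z| ≤ 1 := fun t ht z hz =>
    abs_le.2 ⟨(hF₁ t ht).2.2.1 ▸ ((hF₁ t ht).1 hz.1).le,
      ((hF₁ t ht).1 hz.2).le.trans_eq (hF₁ t ht).2.2.2⟩
  have htend : ∀ k : ℝ, Filter.Tendsto (fun t : ℝ => t) (𝓝[Ioo 0 1] k) (𝓝 k) := fun k =>
    Filter.tendsto_id.mono_left nhdsWithin_le_nhds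
  have hBt₀ : ∀ x ∈ T₀, Filter.Tendsto (fun t => B t (c x)) (𝓝[Ioo 0 1] 0) (𝓝 (c (g₀ x))) := by
    intro x hx
    have h1 := hFt₀ (c x) (Ioo_subset_Icc_self (hcm x)) (hGc₀ x hx).2
    rw [(hGc₀ x hx).1] at h1
    have h2 : Filter.Tendsto (fun t => t * F₁ (1 - t) (c x)) (𝓝[Ioo 0 1] 0) (𝓝 0) := by
      refine squeeze_zero_norm' ?_ (htend 0)
      filter_upwards [self_mem_nhdsWithin] with t ht
      rw [Real.norm_eq_abs, abs_mul, abs_of_pos ht.1]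
      exact mul_le_of_le_one_right ht.1.le (hFb₁ _ (hflip t ht) _ (hcm x))
    simpa using (((tendsto_const_nhds (x := (1 : ℝ))).sub (htend 0)).mul h1).add h2
  have hBt₁ : ∀ x ∈ T₁, Filter.Tendsto (fun t => B t (c x)) (𝓝[Ioo 0 1] 1) (𝓝 (c (g₁ x))) := by
    intro x hx
    have hfl : Filter.Tendsto (fun t : ℝ => 1 - t) (𝓝[Ioo 0 1] 1) (𝓝[Ioo 0 1] 0) := by
      refine tendsto_nhdsWithin_iff.2 ⟨?_, ?_⟩
      · simpa using (tendsto_const_nhds (x := (1 : ℝ))).sub (htend 1)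
      · filter_upwards [self_mem_nhdsWithin] with t ht using hflip t ht
    have h1 := (hFt₁ (c x) (Ioo_subset_Icc_self (hcm x)) (hGc₁ x hx).2).comp hfl
    rw [(hGc₁ x hx).1] at h1
    have h2 : Filter.Tendsto (fun t => (1 - t) * F₀ t (c x)) (𝓝[Ioo 0 1] 1) (𝓝 0) := by
      refine squeeze_zero_norm' ?_ (hfl.mono_right nhdsWithin_le_nhds)
      filter_upwards [self_mem_nhdsWithin] with t ht
      rw [Real.norm_eq_abs, abs_mul, abs_of_pos (hflip t ht).1]
      exact mul_le_of_le_one_right (hflip t ht).1.le (hFb₀ t ht _ (hcm x))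
    simpa using h2.add ((htend 1).mul h1)
  have hdat : ∀ y, ContinuousAt d (c y) := fun y =>
    hd.continuousAt (isOpen_Ioo.mem_nhds (hcm y))
  refine ⟨fun t x => d (B t (c x)), fun t ht => ⟨fun x y hxy => ?_, fun y => ?_⟩, fun x => ?_,
    fun x hx => ?_, fun x hx => ?_⟩
  · rw [← hc.lt_iff_lt, hcd _ (hBm t ht _ (hcm x)), hcd _ (hBm t ht _ (hcm y))]
    exact hB t ht (hc hxy)
  · obtain ⟨z, hz, hzy⟩ := intermediate_value_Icc (by norm_num : (-1 : ℝ) ≤ 1)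
      (hBc t ht).continuousOn (show c y ∈ Icc (B t (-1)) (B t 1) by
        rw [hBl t ht, hBr t ht]; exact Ioo_subset_Icc_self (hcm y))
    have hz' : z ∈ Ioo (-1 : ℝ) 1 := by
      refine ⟨lt_of_le_of_ne hz.1 fun h => ?_, lt_of_le_of_ne hz.2 fun h => ?_⟩
      · rw [← h, hBl t ht] at hzy; exact (hcm y).1.ne hzy
      · rw [h, hBr t ht] at hzy; exact (hcm y).2.ne hzy.symm
    refine ⟨d z, ?_⟩
    simp only
    rw [hcd z hz', hzy, hdc]
  · exact hd.comp (hBtime (c x)) fun t ht => hBm t ht _ (hcm x)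
  · have := (hdat (g₀ x)).tendsto.comp (hBt₀ x hx)
    rwa [hdc] at this
  · have := (hdat (g₁ x)).tendsto.comp (hBt₁ x hx)
    rwa [hdc] at this

/-! ### Extension of boundary maps to homeomorphisms of strips -/

/-- A function on a planar set that is increasing and continuous on horizontal sections and
continuous along vertical lines is continuous. -/
theorem continuousOn_of_sections {C : Set (ℝ × ℝ)} {I : Set ℝ} {A : ℝ × ℝ → ℝ}
    (hCI : ∀ z ∈ C, z.2 ∈ I) (hC₁ : ∀ z ∈ C, ∀ᶠ x in 𝓝 z.1, (x, z.2) ∈ C)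
    (hC₂ : ∀ z ∈ C, ∀ᶠ y in 𝓝[I] z.2, (z.1, y) ∈ C)
    (hmono : ∀ a b y, (a, y) ∈ C → (b, y) ∈ C → a < b → A (a, y) < A (b, y))
    (h₁ : ∀ z ∈ C, ContinuousAt (fun x => A (x, z.2)) z.1)
    (h₂ : ∀ z ∈ C, ContinuousWithinAt (fun y => A (z.1, y)) I z.2) : ContinuousOn A C := by
  intro z hz
  have hfst : Filter.Tendsto (fun w : ℝ × ℝ => w.1) (𝓝[C] z) (𝓝 z.1) :=
    (continuous_fst.tendsto z).mono_left nhdsWithin_le_nhds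
  have hsnd : Filter.Tendsto (fun w : ℝ × ℝ => w.2) (𝓝[C] z) (𝓝[I] z.2) :=
    tendsto_nhdsWithin_iff.2 ⟨(continuous_snd.tendsto z).mono_left nhdsWithin_le_nhds,
      by filter_upwards [self_mem_nhdsWithin] with w hw using hCI w hw⟩
  refine tendsto_order.2 ⟨fun k hk => ?_, fun k hk => ?_⟩
  · obtain ⟨a, ⟨haC, hak⟩, haz⟩ := ((((hC₁ z hz).and
      ((h₁ z hz).eventually_const_lt hk)).filter_mono nhdsWithin_le_nhds).and
        (self_mem_nhdsWithin (s := Iio z.1))).exists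
    filter_upwards [self_mem_nhdsWithin, hfst.eventually_const_lt haz,
      hsnd.eventually (hC₂ (a, z.2) haC),
      hsnd.eventually ((h₂ (a, z.2) haC).eventually_const_lt hak)]
      with w hw h1 h2 h3
    exact h3.trans (hmono a w.1 w.2 h2 hw h1)
  · obtain ⟨a, ⟨haC, hak⟩, haz⟩ := ((((hC₁ z hz).and
      ((h₁ z hz).eventually_lt_const hk)).filter_mono nhdsWithin_le_nhds).and
        (self_mem_nhdsWithin (s := Ioi z.1))).exists
    filter_upwards [self_mem_nhdsWithin, hfst.eventually_lt_const haz,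
      hsnd.eventually (hC₂ (a, z.2) haC),
      hsnd.eventually ((h₂ (a, z.2) haC).eventually_lt_const hak)]
      with w hw h1 h2 h3
    exact (hmono w.1 a w.2 hw h2 h1).trans h3

/-- If `A` is increasing on horizontal sections and continuous along vertical lines, then the
solution `x` of `A (x, y) = k` depends continuously on `(y, k)`. -/
theorem tendsto_of_sections {C : Set (ℝ × ℝ)} {I : Set ℝ} {A : ℝ × ℝ → ℝ}
    (hC₁ : ∀ z ∈ C, ∀ᶠ x in 𝓝 z.1, (x, z.2) ∈ C)
    (hC₂ : ∀ z ∈ C, ∀ᶠ y in 𝓝[I] z.2, (z.1, y) ∈ C)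
    (hmono : ∀ a b y, (a, y) ∈ C → (b, y) ∈ C → a < b → A (a, y) < A (b, y))
    (h₂ : ∀ z ∈ C, ContinuousWithinAt (fun y => A (z.1, y)) I z.2)
    {α : Type*} {l : Filter α} {x y k : α → ℝ} {z : ℝ × ℝ} (hz : z ∈ C)
    (hxy : ∀ i, (x i, y i) ∈ C) (hA : ∀ i, A (x i, y i) = k i)
    (hy : Filter.Tendsto y l (𝓝[I] z.2)) (hk : Filter.Tendsto k l (𝓝 (A z))) :
    Filter.Tendsto x l (𝓝 z.1) := by
  refine tendsto_order.2 ⟨fun b hb => ?_, fun b hb => ?_⟩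
  · obtain ⟨a, haC, hba, haz⟩ := (((hC₁ z hz).filter_mono nhdsWithin_le_nhds).and
      (Ioo_mem_nhdsLT hb)).exists
    obtain ⟨m, hm, hm'⟩ := exists_between (hmono a z.1 z.2 haC hz haz)
    filter_upwards [hy.eventually (hC₂ (a, z.2) haC), hk.eventually_const_lt hm',
      hy.eventually ((h₂ (a, z.2) haC).eventually_lt_const hm)] with i h1 h2 h3
    by_contra! hle
    have := (hmono _ a _ (hxy i) h1 (hle.trans_lt hba))
    rw [hA] at this
    exact lt_irrefl _ (this.trans (h3.trans h2))
  · obtain ⟨a, haC, haz, hba⟩ := (((hC₁ z hz).filter_mono nhdsWithin_le_nhds).and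
      (Ioo_mem_nhdsGT hb)).exists
    obtain ⟨m, hm, hm'⟩ := exists_between (hmono z.1 a z.2 hz haC haz)
    filter_upwards [hy.eventually (hC₂ (a, z.2) haC), hk.eventually_lt_const hm,
      hy.eventually ((h₂ (a, z.2) haC).eventually_const_lt hm')] with i h1 h2 h3
    by_contra! hle
    have := (hmono a _ _ h1 (hxy i) (hba.trans_le hle))
    rw [hA] at this
    exact lt_irrefl _ (this.trans (h2.trans h3))

namespace Strip

theorem eventually_fst (S : Strip) {z : ℝ × ℝ} (hz : z ∈ S.carrier) :
    ∀ᶠ x in 𝓝 z.1, (x, z.2) ∈ S.carrier := by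
  obtain ⟨U, hU, h⟩ := S.relatively_open
  have hI := S.mem_Icc hz
  rw [h] at hz ⊢
  have hc : Continuous fun x : ℝ => (x, z.2) := by fun_prop
  filter_upwards [hc.continuousAt.preimage_mem_nhds (hU.mem_nhds hz.1)] with x hx
  exact ⟨hx, mem_univ _, hI⟩

theorem eventually_snd (S : Strip) {z : ℝ × ℝ} (hz : z ∈ S.carrier) :
    ∀ᶠ y in 𝓝[Icc S.u S.v] z.2, (z.1, y) ∈ S.carrier := by
  obtain ⟨U, hU, h⟩ := S.relatively_open
  rw [h] at hz ⊢
  have hc : Continuous fun y : ℝ => (z.1, y) := by fun_prop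
  filter_upwards [nhdsWithin_le_nhds (hc.continuousAt.preimage_mem_nhds (hU.mem_nhds hz.1)),
    self_mem_nhdsWithin] with y hy hI
  exact ⟨hy, mem_univ _, hI⟩

/-- The affine map between the heights of two strips in the direction `t`. -/
theorem exists_height_homeomorph (S S' : Strip) (t : ℤˣ) :
    ∃ β : ℝ ≃ₜ ℝ, (∀ s, β (S.level s) = S'.level (t * s)) ∧
      (∀ y y', y < y' → Signed t (· < ·) (β y) (β y')) ∧
      ∀ y, β y ∈ Ioo S'.u S'.v ↔ y ∈ Ioo S.u S.v := by
  have hd : 0 < S.v - S.u := sub_pos.2 S.u_lt_v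
  have hs : Signed t (· < ·) (S'.level (-t)) (S'.level t) := by
    rcases Int.units_eq_one_or t with rfl | rfl
    · rw [level_one, level_neg_one]; exact signed_one.2 S'.u_lt_v
    · rw [neg_neg, level_one, level_neg_one]; exact signed_neg_one.2 S'.u_lt_v
  have hne : S'.level t - S'.level (-t) ≠ 0 := sub_ne_zero.2 hs.ne.symm
  let m := (S'.level t - S'.level (-t)) / (S.v - S.u)
  have hm : m ≠ 0 := div_ne_zero hne hd.ne'
  let β := affineHomeomorph m (S'.level (-t) - m * S.u) hm
  have hβ : ∀ y, β y = S'.level (-t) + m * (y - S.u) := fun y => by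
    show m * y + (S'.level (-t) - m * S.u) = _
    ring
  have hl : ∀ s, β (S.level s) = S'.level (t * s) := fun s => by
    rcases Int.units_eq_one_or s with rfl | rfl
    · rw [hβ, level_one, mul_one, div_mul_cancel₀ _ hd.ne']; ring
    · rw [hβ, level_neg_one, mul_neg_one]; ring
  have hsg : ∀ y y', y < y' → Signed t (· < ·) (β y) (β y') := fun y y' hy => by
    have h1 := signed_lt_iff.1 hs
    rw [signed_lt_iff, hβ, hβ]
    have h2 : 0 < ((t : ℤ) : ℝ) * m := by
      simp only [m]
      rw [← mul_div_assoc]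
      exact div_pos (by linarith) hd
    nlinarith
  refine ⟨β, hl, hsg, fun y => ?_⟩
  have h1 := hl 1
  have h2 := hl (-1)
  rcases Int.units_eq_one_or t with rfl | rfl
  · have hmono : StrictMono β := fun a b hab => signed_one.1 (hsg a b hab)
    rw [mul_one, level_one, level_one] at h1
    rw [one_mul, level_neg_one, level_neg_one] at h2
    rw [mem_Ioo, mem_Ioo, ← h1, ← h2, hmono.lt_iff_lt, hmono.lt_iff_lt]
  · have hanti : StrictAnti β := fun a b hab => signed_neg_one.1 (hsg a b hab)
    rw [mul_one, level_one, level_neg_one] at h1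
    rw [neg_mul_neg, mul_one, level_neg_one, level_one] at h2
    rw [mem_Ioo, mem_Ioo, ← h1, ← h2, hanti.lt_iff_gt, hanti.lt_iff_gt, and_comm]

/-- The extension of strictly increasing functions on the two sides of a strip to a function on
the strip that is increasing on all horizontal sections and bijective on the interior ones. -/
theorem exists_extension (S : Strip) {g : ℤˣ → ℝ → ℝ}
    (hg : ∀ s, StrictMonoOn (g s) (S.trace s)) (hgo : ∀ s, IsOpen (g s '' S.trace s)) :
    ∃ A : ℝ × ℝ → ℝ, (∀ s, ∀ x ∈ S.trace s, A (x, S.level s) = g s x) ∧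
      (∀ y ∈ Ioo S.u S.v, Function.Surjective fun x => A (x, y)) ∧
      (∀ a b y, (a, y) ∈ S.carrier → (b, y) ∈ S.carrier → a < b → A (a, y) < A (b, y)) ∧
      (∀ z ∈ S.carrier, ContinuousAt (fun x => A (x, z.2)) z.1) ∧
      ∀ z ∈ S.carrier, ContinuousWithinAt (fun y => A (z.1, y)) (Icc S.u S.v) z.2 := by
  classical
  have hgc : ∀ s, ∀ x ∈ S.trace s, ContinuousAt (g s) x := fun s x hx =>
    (hg s).continuousAt_of_image_mem_nhds ((S.isOpen_trace s).mem_nhds hx)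
      ((hgo s).mem_nhds (mem_image_of_mem _ hx))
  obtain ⟨a, ha, hac, ha₀, ha₁⟩ := exists_isotopy (S.isOpen_trace (-1)) (S.isOpen_trace 1)
    (hg (-1)) (hg 1) (fun x hx => (hgc _ x hx).continuousWithinAt)
    (fun x hx => (hgc _ x hx).continuousWithinAt)
  have hd : 0 < S.v - S.u := sub_pos.2 S.u_lt_v
  let θ : ℝ → ℝ := fun y => (y - S.u) / (S.v - S.u)
  have hθc : Continuous θ := by fun_prop
  have hθ : ∀ y ∈ Ioo S.u S.v, θ y ∈ Ioo (0 : ℝ) 1 := fun y hy =>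
    ⟨div_pos (by linarith [hy.1]) hd, (div_lt_one hd).2 (by linarith [hy.2])⟩
  let A : ℝ × ℝ → ℝ := fun z =>
    if z.2 = S.u then g (-1) z.1 else if z.2 = S.v then g 1 z.1 else a (θ z.2) z.1
  have hAi : ∀ x, ∀ y ∈ Ioo S.u S.v, A (x, y) = a (θ y) x := fun x y hy => by
    simp only [A]; rw [if_neg hy.1.ne', if_neg hy.2.ne]
  have hAl : ∀ s x, A (x, S.level s) = g s x := fun s x => by
    rcases Int.units_eq_one_or s with rfl | rfl
    · simp [A, level_one, S.u_lt_v.ne']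
    · simp [A, level_neg_one]
  refine ⟨A, fun s x _ => hAl s x, fun y hy => ?_, fun b c y hb hc hbc => ?_, fun z hz => ?_,
    fun z hz => ?_⟩
  · simp only [hAi _ y hy]; exact (ha _ (hθ y hy)).2
  · by_cases hy : y ∈ Ioo S.u S.v
    · rw [hAi b y hy, hAi c y hy]; exact (ha _ (hθ y hy)).1 hbc
    · obtain ⟨s, hs⟩ := S.eq_level_of_notMem_Ioo hb hy
      obtain rfl : y = S.level s := hs
      rw [hAl, hAl]
      exact hg s hb hc hbc
  · by_cases hy : z.2 ∈ Ioo S.u S.v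
    · simp only [hAi _ _ hy]
      have := ha _ (hθ _ hy)
      exact (this.1.monotone.continuous_of_surjective this.2).continuousAt
    · obtain ⟨s, hs⟩ := S.eq_level_of_notMem_Ioo hz hy
      have hz' : z.1 ∈ S.trace s := by
        show (z.1, S.level s) ∈ S.carrier
        rw [← hs]; exact hz
      simp only [hs, hAl]
      exact hgc s _ hz'
  · by_cases hy : z.2 ∈ Ioo S.u S.v
    · have h1 : ContinuousAt (fun y => a (θ y) z.1) z.2 :=
        ContinuousAt.comp (g := fun r => a r z.1)
          ((hac z.1).continuousAt (isOpen_Ioo.mem_nhds (hθ _ hy))) hθc.continuousAt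
      refine (h1.congr ?_).continuousWithinAt
      filter_upwards [isOpen_Ioo.mem_nhds hy] with y hy'
      exact (hAi _ _ hy').symm
    · obtain ⟨s, hs⟩ := S.eq_level_of_notMem_Ioo hz hy
      have hz' : z.1 ∈ S.trace s := by
        show (z.1, S.level s) ∈ S.carrier
        rw [← hs]; exact hz
      -- Near a side, the closed interval of heights is its end point and the open interval.
      have key : ∀ k, θ (S.level s) = k →
          Filter.Tendsto (fun r => a r z.1) (𝓝[Ioo 0 1] k) (𝓝 (g s z.1)) →
          ContinuousWithinAt (fun y => A (z.1, y)) (Icc S.u S.v) (S.level s) := by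
        intro k hk h
        have hθt : Filter.Tendsto θ (𝓝[Ioo S.u S.v] (S.level s)) (𝓝[Ioo 0 1] k) :=
          tendsto_nhdsWithin_iff.2 ⟨hk ▸ (hθc.tendsto _).mono_left nhdsWithin_le_nhds,
            by filter_upwards [self_mem_nhdsWithin] with y hy using hθ y hy⟩
        have h1 : ContinuousWithinAt (fun y => A (z.1, y)) (Ioo S.u S.v) (S.level s) := by
          show Filter.Tendsto _ _ (𝓝 (A (z.1, S.level s)))
          rw [hAl]
          refine (h.comp hθt).congr' ?_
          filter_upwards [self_mem_nhdsWithin] with y hy using (hAi _ _ hy).symm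
        refine (continuousWithinAt_insert_self.2 h1).mono_of_mem_nhdsWithin ?_
        have hlv : S.level s = S.u ∨ S.level s = S.v := by
          rcases Int.units_eq_one_or s with rfl | rfl
          · exact Or.inr S.level_one
          · exact Or.inl S.level_neg_one
        rcases hlv with h' | h' <;> rw [h']
        · filter_upwards [self_mem_nhdsWithin,
            nhdsWithin_le_nhds (isOpen_Iio.mem_nhds S.u_lt_v)] with y hy1 hy2
          exact hy1.1.eq_or_lt.imp Eq.symm fun h => ⟨h, hy2⟩
        · filter_upwards [self_mem_nhdsWithin,
            nhdsWithin_le_nhds (isOpen_Ioi.mem_nhds S.u_lt_v)] with y hy1 hy2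
          exact hy1.2.eq_or_lt.imp id fun h => ⟨hy2, h⟩
      rw [hs]
      rcases Int.units_eq_one_or s with rfl | rfl
      · exact key 1 (by simp only [θ, level_one]; exact div_self hd.ne') (ha₁ _ hz')
      · exact key 0 (by simp only [θ, level_neg_one, sub_self, zero_div]) (ha₀ _ hz')

/-- Monotone bijections between the sides of two strips, with a common horizontal direction `e`,
extend to a homeomorphism of the strips that maps horizontal lines to horizontal lines in the
direction `e` and has vertical direction `t`. -/
theorem exists_homeomorph (S S' : Strip) (e t : ℤˣ) {g : ℤˣ → ℝ → ℝ}
    (hg : ∀ s, BijOn (g s) (S.trace s) (S'.trace (t * s)))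
    (hmono : ∀ s, ∀ a ∈ S.trace s, ∀ b ∈ S.trace s, a < b → Signed e (· < ·) (g s a) (g s b)) :
    ∃ h : S.carrier ≃ₜ S'.carrier,
      (∀ s (p : S.carrier), p.1.2 = S.level s → (h p).1 = (g s p.1.1, S'.level (t * s))) ∧
      (∀ p, (h p).1.2 ∈ Ioo S'.u S'.v ↔ p.1.2 ∈ Ioo S.u S.v) ∧
      (∀ p p', (h p).1.2 = (h p').1.2 ↔ p.1.2 = p'.1.2) ∧
      (∀ p p', p.1.2 = p'.1.2 → p.1.1 < p'.1.1 → Signed e (· < ·) (h p).1.1 (h p').1.1) ∧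
      ∀ p p', p.1.2 < p'.1.2 → Signed t (· < ·) (h p).1.2 (h p').1.2 := by
  -- Multiplication by the sign `E` reduces the construction to increasing functions.
  let E : ℝ := ((e : ℤ) : ℝ)
  have hE : ∀ x, E * (E * x) = x := fun x => by
    rw [← mul_assoc]
    rcases Int.units_eq_one_or e with he | he <;> simp [E, he]
  have hEc : Continuous fun x => E * x := by fun_prop
  obtain ⟨β, hβl, hβs, hβi⟩ := exists_height_homeomorph S S' t
  obtain ⟨A, hAl, hAs, hAm, hA₁, hA₂⟩ := S.exists_extension (g := fun s x => E * g s x)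
    (fun s a ha b hb hab => signed_lt_iff.1 (hmono s a ha b hb hab)) (fun s => by
      have h1 : (fun x => E * g s x) '' S.trace s = (fun x => E * x) ⁻¹' S'.trace (t * s) := by
        rw [← (hg s).image_eq]
        ext x
        constructor
        · rintro ⟨a, ha, rfl⟩
          exact ⟨a, ha, (hE _).symm⟩
        · rintro ⟨a, ha, hax⟩
          exact ⟨a, ha, by simp only [hax, hE]⟩
      rw [h1]
      exact (S'.isOpen_trace _).preimage hEc)
  let F : ℝ × ℝ → ℝ × ℝ := fun z => (E * A z, β z.2)
  have hFl : ∀ s, ∀ x ∈ S.trace s, F (x, S.level s) = (g s x, S'.level (t * s)) := fun s x hx => by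
    simp only [F, hAl s x hx, hE, hβl]
  have hF : BijOn F S.carrier S'.carrier := by
    refine ⟨fun z hz => ?_, fun z hz w hw h => ?_, fun w hw => ?_⟩
    · by_cases hi : z.2 ∈ Ioo S.u S.v
      · exact S'.mem_carrier_of_mem_Ioo ((hβi _).2 hi)
      · obtain ⟨s, hs⟩ := S.eq_level_of_notMem_Ioo hz hi
        obtain ⟨x, y⟩ := z
        obtain rfl : y = S.level s := hs
        rw [hFl s x hz]
        exact (hg s).mapsTo hz
    · have h1 : z.2 = w.2 := β.injective (congrArg Prod.snd h)
      have h2 : A z = A w := by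
        rw [← hE (A z), ← hE (A w)]
        exact congrArg (E * ·) (congrArg Prod.fst h)
      obtain ⟨x, y⟩ := z
      obtain ⟨x', y'⟩ := w
      obtain rfl : y = y' := h1
      rcases lt_trichotomy x x' with h3 | rfl | h3
      · exact absurd h2 (hAm _ _ _ hz hw h3).ne
      · rfl
      · exact absurd h2 (hAm _ _ _ hw hz h3).ne'
    · by_cases hi : w.2 ∈ Ioo S'.u S'.v
      · have hi' : β.symm w.2 ∈ Ioo S.u S.v := (hβi _).1 (by rwa [β.apply_symm_apply])
        obtain ⟨x, hx⟩ := hAs _ hi' (E * w.1)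
        simp only at hx
        refine ⟨(x, β.symm w.2), S.mem_carrier_of_mem_Ioo hi', Prod.ext ?_ (β.apply_symm_apply _)⟩
        simp only [F]
        rw [hx, hE]
      · obtain ⟨s, hs⟩ := S'.eq_level_of_notMem_Ioo hw hi
        obtain ⟨x, y⟩ := w
        have hts : t * (t * s) = s := by rw [← mul_assoc, Int.units_mul_self, one_mul]
        obtain rfl : y = S'.level (t * (t * s)) := by rw [hts]; exact hs
        obtain ⟨b, hb, rfl⟩ := (hg (t * s)).surjOn hw
        exact ⟨(b, S.level (t * s)), hb, hFl _ _ hb⟩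
  have hAc : ContinuousOn A S.carrier := continuousOn_of_sections (fun z hz => S.mem_Icc hz)
    (fun z => S.eventually_fst) (fun z => S.eventually_snd) hAm hA₁ hA₂
  let h₀ : S.carrier ≃ S'.carrier := hF.equiv
  have hh₀ : ∀ p, (h₀ p).1 = F p.1 := fun p => rfl
  have hsymm : ∀ w, F (h₀.symm w).1 = w.1 := fun w => by rw [← hh₀, h₀.apply_symm_apply]
  have hAc' : Continuous fun p : S.carrier => A p.1 := continuousOn_iff_continuous_domRestrict.1 hAc
  have hsnd : ∀ w, (h₀.symm w).1.2 = β.symm w.1.2 := fun w =>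
    (β.symm_apply_eq.2 (congrArg Prod.snd (hsymm w)).symm).symm
  let h : S.carrier ≃ₜ S'.carrier :=
    { toEquiv := h₀
      continuous_toFun := by
        have : Continuous fun p : S.carrier => F p.1 :=
          (continuous_const.mul hAc').prodMk (β.continuous.comp (by fun_prop))
        exact this.subtype_mk _
      continuous_invFun := by
        have h2 : Continuous fun w => (h₀.symm w).1.2 := by simp only [hsnd]; fun_prop
        have h1 : Continuous fun w => (h₀.symm w).1.1 := by
          refine continuous_iff_continuousAt.2 fun w => ?_
          refine tendsto_of_sections (I := Icc S.u S.v) (fun z => S.eventually_fst)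
            (fun z => S.eventually_snd) hAm hA₂ (h₀.symm w).2 (y := fun w => (h₀.symm w).1.2)
            (k := fun w => E * w.1.1) (fun w => (h₀.symm w).2) (fun w => ?_)
            (tendsto_nhdsWithin_iff.2 ⟨h2.tendsto w,
              Filter.Eventually.of_forall fun w => S.mem_Icc (h₀.symm w).2⟩) ?_
          · rw [← hsymm w]
            exact (hE _).symm
          · have hv : A (h₀.symm w).1 = E * w.1.1 := by
              rw [← hsymm w]
              exact (hE _).symm
            rw [hv]
            exact (show Continuous fun w : S'.carrier => E * w.1.1 by fun_prop).tendsto w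
        exact (h1.prodMk h2).subtype_mk fun w => (h₀.symm w).2 }
  refine ⟨h, fun s p hp => ?_, fun p => hβi _, fun p p' => β.injective.eq_iff,
    fun p p' hy hx => ?_, fun p p' hy => hβs _ _ hy⟩
  · obtain ⟨⟨x, y⟩, hp'⟩ := p
    obtain rfl : y = S.level s := hp
    exact hFl s x hp'
  · obtain ⟨⟨x, y⟩, hp⟩ := p
    obtain ⟨⟨x', y'⟩, hp'⟩ := p'
    obtain rfl : y = y' := hy
    refine signed_lt_iff.2 ?_
    show E * (E * A (x, y)) < E * (E * A (x', y))
    rw [hE, hE]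
    exact hAm _ _ _ hp hp' hx

end Strip

/-! ### The equivalence of striped atlases that realizes an isomorphism of graphs -/

/-- Compressing the line makes every open interval bounded, so that an affine map finishes. -/
theorem exists_bijOn_Ioo {I : Set ℝ} (hI : IsOpen I) (hc : I.OrdConnected) (hn : I.Nonempty) :
    ∃ φ : ℝ → ℝ, StrictMonoOn φ I ∧ BijOn φ I (Ioo (-1) 1) := by
  obtain ⟨c, d, hcm, hcc, hcI, hdc, hcd, hd⟩ := exists_compression
  let K := c '' I
  have hKo : IsOpen K := by
    have : K = Ioo (-1) 1 ∩ d ⁻¹' I := by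
      ext z
      constructor
      · rintro ⟨x, hx, rfl⟩
        exact ⟨hcI x, by rwa [mem_preimage, hdc]⟩
      · rintro ⟨hz, hz'⟩
        exact ⟨d z, hz', hcd z hz⟩
    rw [this]
    exact hd.isOpen_inter_preimage isOpen_Ioo hI
  have hKn : K.Nonempty := hn.image c
  have hKb : BddBelow K := ⟨-1, by rintro _ ⟨x, -, rfl⟩; exact (hcI x).1.le⟩
  have hKa : BddAbove K := ⟨1, by rintro _ ⟨x, -, rfl⟩; exact (hcI x).2.le⟩
  have hKs : Ioo (sInf K) (sSup K) ⊆ K :=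
    IsConnected.Ioo_csInf_csSup_subset ⟨hKn, hc.isPreconnected.image c hcc.continuousOn⟩ hKb hKa
  have hKs' : ∀ z ∈ K, z ∈ Ioo (sInf K) (sSup K) := fun z hz => by
    have h1 : ∀ᶠ w in 𝓝 z, w ∈ K := hKo.mem_nhds hz
    obtain ⟨w, hw, hwz⟩ := ((h1.filter_mono nhdsWithin_le_nhds).and
      (self_mem_nhdsWithin (s := Iio z))).exists
    obtain ⟨w', hw', hwz'⟩ := ((h1.filter_mono nhdsWithin_le_nhds).and
      (self_mem_nhdsWithin (s := Ioi z))).exists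
    exact ⟨(csInf_le hKb hw).trans_lt hwz, (show z < w' from hwz').trans_le (le_csSup hKa hw')⟩
  obtain ⟨z₀, hz₀⟩ := hKn
  set a := sInf K
  set b := sSup K
  have hab : 0 < b - a := sub_pos.2 ((hKs' z₀ hz₀).1.trans (hKs' z₀ hz₀).2)
  let φ : ℝ → ℝ := fun x => (2 * c x - a - b) / (b - a)
  have hφ : StrictMono φ := fun x y hxy => by
    have := hcm hxy
    simp only [φ]
    gcongr
  refine ⟨φ, hφ.strictMonoOn _, fun x hx => ?_, hφ.injective.injOn, fun w hw => ?_⟩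
  · obtain ⟨h1, h2⟩ := hKs' _ (mem_image_of_mem c hx)
    refine ⟨?_, ?_⟩
    · simp only [φ]; rw [lt_div_iff₀ hab]; linarith
    · simp only [φ]; rw [div_lt_one hab]; linarith
  · obtain ⟨x, hx, hxw⟩ := hKs (show (w * (b - a) + a + b) / 2 ∈ Ioo a b by
      constructor <;> nlinarith [hw.1, hw.2])
    refine ⟨x, hx, ?_⟩
    simp only [φ, hxw]
    field_simp
    ring

/-- Two nonempty open intervals are related by a monotone bijection in any given direction. -/
theorem exists_bijOn_signed {I J : Set ℝ} (hI : IsOpen I) (hIc : I.OrdConnected)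
    (hIn : I.Nonempty) (hJ : IsOpen J) (hJc : J.OrdConnected) (hJn : J.Nonempty) (e : ℤˣ) :
    ∃ m : ℝ → ℝ, BijOn m I J ∧ ∀ a ∈ I, ∀ b ∈ I, a < b → Signed e (· < ·) (m a) (m b) := by
  obtain ⟨φ, hφ, hφb⟩ := exists_bijOn_Ioo hI hIc hIn
  obtain ⟨ψ, hψ, hψb⟩ := exists_bijOn_Ioo hJ hJc hJn
  have he : BijOn (fun x => ((e : ℤ) : ℝ) * x) (Ioo (-1) 1) (Ioo (-1) 1) := by
    rcases Int.units_eq_one_or e with rfl | rfl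
    · simpa [Function.id_def] using bijOn_id (Ioo (-1 : ℝ) 1)
    · refine ⟨fun x hx => ?_, fun x _ y _ h => by simpa using h, fun x hx => ⟨-x, ?_, by simp⟩⟩
      · simp only [Units.val_neg, Units.val_one, Int.cast_neg, Int.cast_one, neg_mul, one_mul]
        exact ⟨by linarith [hx.2], by linarith [hx.1]⟩
      · exact ⟨by linarith [hx.2], by linarith [hx.1]⟩
  have hinv := hψb.invOn_invFunOn
  have hb := (hψb.symm hinv.symm).comp (he.comp hφb)
  refine ⟨_, hb, fun a ha b hbI hab => ?_⟩
  have key : ∀ x ∈ I, ψ (Function.invFunOn ψ J (((e : ℤ) : ℝ) * φ x)) = ((e : ℤ) : ℝ) * φ x :=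
    fun x hx => hinv.2 ((he.comp hφb).mapsTo hx)
  have hlt := hφ ha hbI hab
  rcases Int.units_eq_one_or e with rfl | rfl
  · refine signed_one.2 ((hψ.lt_iff_lt (hb.mapsTo ha) (hb.mapsTo hbI)).1 ?_)
    simp only [Function.comp_apply]
    rw [key a ha, key b hbI]
    simpa using hlt
  · refine signed_neg_one.2 ((hψ.lt_iff_lt (hb.mapsTo hbI) (hb.mapsTo ha)).1 ?_)
    simp only [Function.comp_apply]
    rw [key a ha, key b hbI]
    simpa using hlt

namespace StripedGraph.Iso

variable {Λ Γ Z Λ' Γ' Z' : Type*} [TopologicalSpace Z] [TopologicalSpace Z']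
  {A : StripedAtlas Λ Γ Z} {A' : StripedAtlas Λ' Γ' Z'}

open StripedAtlas

variable (f : A.graph.Iso A'.graph)

theorem η_mem_d (X : HalfEdge A.S) :
    (f.η X).vertex = f.ν X.vertex ∧ (f.η X).side = f.τ X.vertex * X.side := by
  have h : f.η X ∈ f.η '' A.graph.d X.vertex X.side := mem_image_of_mem _ ⟨rfl, rfl⟩
  rw [f.image_d] at h
  exact h

theorem ξ_η (X : HalfEdge A.S) : A'.ξ (f.η X) = f.η (A.ξ X) := f.comm X

theorem ξ_η_ne {X : HalfEdge A.S} (hX : A.ξ X ≠ X) : A'.ξ (f.η X) ≠ f.η X := by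
  rw [f.ξ_η]
  exact fun h => hX (f.η.injective h)

/-- The compatibility with the orientations of gluing: the direction on the strip of `Y` is that
of the composition of the gluing map of `Y`, a map from `ξ Y` to `η (ξ Y)` in the direction of the
strip of `ξ Y`, and the gluing map of `η (ξ Y)`. -/
theorem ε_eq {Y : HalfEdge A.S} (hY : A.ξ Y ≠ Y) :
    f.ε Y.vertex = A'.σ ⟨f.η (A.ξ Y), f.ξ_η_ne (A.ξ_ne hY)⟩ *
      (f.ε (A.ξ Y).vertex * A.σ ⟨Y, hY⟩) := by
  have h1 : f.ε (A.ξ Y).vertex * A.σ ⟨A.ξ Y, A.ξ_ne hY⟩ =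
      A'.σ ⟨f.η (A.ξ Y), f.ξ_η_ne (A.ξ_ne hY)⟩ * f.ε (A.ξ (A.ξ Y)).vertex :=
    f.compat (A.ξ Y) (A.ξ_ne hY) (f.ξ_η_ne (A.ξ_ne hY))
  have h2 : A.σ ⟨A.ξ Y, A.ξ_ne hY⟩ = A.σ ⟨Y, hY⟩ := A.graph.σ_ξ Y hY (A.ξ_ne hY)
  rw [h2, A.ξ_involutive] at h1
  rw [h1, ← mul_assoc, Int.units_mul_self, one_mul]

/-- Monotone bijections between corresponding boundary intervals that are compatible with the
gluing maps: they are arbitrary except on the intervals `Y γ`, where they are determined by the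
gluing. The compatibility of an isomorphism of graphs with the orientations of gluing gives the
determined bijections the right direction. -/
theorem exists_boundary_maps : ∃ m : HalfEdge A.S → ℝ → ℝ,
    (∀ X, BijOn (m X) X.interval (f.η X).interval) ∧
    (∀ X : HalfEdge A.S, ∀ a ∈ X.interval, ∀ b ∈ X.interval, a < b →
      Signed (f.ε X.vertex) (· < ·) (m X a) (m X b)) ∧
    ∀ X, A.ξ X ≠ X → ∀ a ∈ X.interval, ∀ b ∈ (A.ξ X).interval,
      A.q (X.pt a) = A.q ((A.ξ X).pt b) →
        A'.q ((f.η X).pt (m X a)) = A'.q ((f.η (A.ξ X)).pt (m (A.ξ X) b)) := by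
  classical
  choose m₀ hm₀ hs₀ using fun X : HalfEdge A.S => exists_bijOn_signed X.isOpen_interval
    X.ordConnected_interval X.interval_nonempty (f.η X).isOpen_interval
    (f.η X).ordConnected_interval (f.η X).interval_nonempty (f.ε X.vertex)
  choose π _ hπb hπq hπs using fun (X : HalfEdge A.S) (hX : A.ξ X ≠ X) => exists_transfer hX
  choose π' _ hπb' hπq' hπs' using
    fun (X : HalfEdge A'.S) (hX : A'.ξ X ≠ X) => exists_transfer hX
  have hY : ∀ {X : HalfEdge A.S}, (∃ γ, A.Y γ = X) → A.ξ X ≠ X := by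
    rintro X ⟨γ, rfl⟩
    exact fun h => (ξ_eq_of_fixed h).2 γ rfl
  let m : HalfEdge A.S → ℝ → ℝ := fun X => if h : ∃ γ, A.Y γ = X then
    π' (f.η (A.ξ X)) (f.ξ_η_ne (A.ξ_ne (hY h))) ∘ m₀ (A.ξ X) ∘ π X (hY h) else m₀ X
  have hmY : ∀ {X : HalfEdge A.S} (h : ∃ γ, A.Y γ = X), m X =
      π' (f.η (A.ξ X)) (f.ξ_η_ne (A.ξ_ne (hY h))) ∘ m₀ (A.ξ X) ∘ π X (hY h) := fun h => dif_pos h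
  have hmX : ∀ {X : HalfEdge A.S}, (¬ ∃ γ, A.Y γ = X) → m X = m₀ X := fun h => dif_neg h
  have key : ∀ γ, ∀ a ∈ (A.X γ).interval, ∀ b ∈ (A.Y γ).interval,
      A.q ((A.X γ).pt a) = A.q ((A.Y γ).pt b) →
        A'.q ((f.η (A.X γ)).pt (m (A.X γ) a)) = A'.q ((f.η (A.Y γ)).pt (m (A.Y γ) b)) := by
    intro γ a ha b hb hq
    have hYγ : ∃ δ, A.Y δ = A.Y γ := ⟨γ, rfl⟩
    have hXγ : ¬ ∃ δ, A.Y δ = A.X γ := fun ⟨δ, h⟩ => A.X_ne_Y γ δ h.symm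
    -- The gluing map takes `b` back to `a`, since `q` is injective on `X γ`.
    have h1 : π (A.Y γ) (hY hYγ) b = a := by
      have h2 := hπq (A.Y γ) (hY hYγ) b hb
      have h3 := (hπb (A.Y γ) (hY hYγ)).mapsTo hb
      rw [← hq] at h2
      have hξ : A.ξ (A.X γ) ≠ A.X γ := fun h => (ξ_eq_of_fixed h).1 γ rfl
      simp only [A.ξ_Y] at h2 h3
      have := congrArg StripSum.x
        (injOn_glued hξ (HalfEdge.pt_mem h3) (HalfEdge.pt_mem ha) h2)
      rwa [HalfEdge.pt_x h3, HalfEdge.pt_x ha] at this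
    have h4 := hπq' (f.η (A.ξ (A.Y γ))) (f.ξ_η_ne (A.ξ_ne (hY hYγ)))
      (m₀ (A.ξ (A.Y γ)) a) ((hm₀ _).mapsTo (by rwa [A.ξ_Y]))
    rw [f.ξ_η, A.ξ_involutive] at h4
    rw [hmX hXγ, hmY hYγ]
    simp only [Function.comp_apply, h1]
    rw [h4, A.ξ_Y]
  refine ⟨m, fun X => ?_, fun X => ?_, fun X hX a ha b hb hq => ?_⟩
  · by_cases h : ∃ γ, A.Y γ = X
    · have h1 := hπb' (f.η (A.ξ X)) (f.ξ_η_ne (A.ξ_ne (hY h)))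
      have h2 := h1.comp ((hm₀ (A.ξ X)).comp (hπb X (hY h)))
      rw [f.ξ_η, A.ξ_involutive] at h2
      rw [hmY h]
      exact h2
    · rw [hmX h]; exact hm₀ X
  · by_cases h : ∃ γ, A.Y γ = X
    · intro a ha b hb hab
      rw [hmY h, f.ε_eq (hY h)]
      have hb₁ := hπb X (hY h)
      exact Signed.map (hπs' _ _) ((hm₀ _).mapsTo (hb₁.mapsTo ha))
        ((hm₀ _).mapsTo (hb₁.mapsTo hb)) (Signed.map (hs₀ _) (hb₁.mapsTo ha) (hb₁.mapsTo hb)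
          (hπs X (hY h) a ha b hb hab))
    · rw [hmX h]; exact hs₀ X
  · obtain ⟨γ, rfl | rfl⟩ := A.exists_glued hX
    · simp only [A.ξ_X] at hb hq ⊢
      exact key γ a ha b hb hq
    · simp only [A.ξ_Y] at hb hq ⊢
      exact (key γ b hb a ha hq.symm).symm

variable {f}

/-- The bijections between corresponding boundary intervals combine to monotone bijections
between corresponding sides of the strips. -/
theorem exists_side_maps {m : HalfEdge A.S → ℝ → ℝ}
    (hb : ∀ X, BijOn (m X) X.interval (f.η X).interval)
    (hs : ∀ X : HalfEdge A.S, ∀ a ∈ X.interval, ∀ b ∈ X.interval, a < b →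
      Signed (f.ε X.vertex) (· < ·) (m X a) (m X b)) (l : Λ) :
    ∃ g : ℤˣ → ℝ → ℝ,
      (∀ X : HalfEdge A.S, X.vertex = l → ∀ a ∈ X.interval, g X.side a = m X a) ∧
      (∀ s, BijOn (g s) ((A.S l).trace s) ((A'.S (f.ν l)).trace (f.τ l * s))) ∧
      ∀ s, ∀ a ∈ (A.S l).trace s, ∀ b ∈ (A.S l).trace s, a < b →
        Signed (f.ε l) (· < ·) (g s a) (g s b) := by
  classical
  let g : ℤˣ → ℝ → ℝ := fun s a =>
    if h : ∃ X : HalfEdge A.S, X.vertex = l ∧ X.side = s ∧ a ∈ X.interval then m h.choose a else 0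
  have hg : ∀ X : HalfEdge A.S, X.vertex = l → ∀ a ∈ X.interval, g X.side a = m X a := by
    intro X hl a ha
    have h : ∃ Y : HalfEdge A.S, Y.vertex = l ∧ Y.side = X.side ∧ a ∈ Y.interval :=
      ⟨X, hl, rfl, ha⟩
    have hX : h.choose = X := HalfEdge.eq_of_mem (h.choose_spec.1.trans hl.symm)
      h.choose_spec.2.1 h.choose_spec.2.2 ha
    simp only [g]
    rw [dif_pos h, hX]
  have hmono : ∀ s, ∀ a ∈ (A.S l).trace s, ∀ b ∈ (A.S l).trace s, a < b →
      Signed (f.ε l) (· < ·) (g s a) (g s b) := by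
    intro s a ha b hb' hab
    obtain ⟨X, hl, rfl, haX⟩ := HalfEdge.exists_interval_mem ha
    obtain ⟨Y, hlY, hsY, hbY⟩ := HalfEdge.exists_interval_mem hb'
    by_cases hXY : X = Y
    · subst hXY
      rw [hg X hl a haX, hg X hl b hbY, ← hl]
      exact hs X a haX b hbY hab
    · have hlt : X.Lt Y :=
        HalfEdge.lt_of_mem (hl.trans hlY.symm) hsY.symm hXY haX hbY hab
      have h1 := f.monotone l X.side X ⟨hl, rfl⟩ Y ⟨hlY, hsY⟩ hlt
      rw [hg X hl a haX, ← hsY, hg Y hlY b hbY]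
      exact h1.imp (fun h => ⟨h.1, h.2.2.2 _ ((hb X).mapsTo haX) _ ((hb Y).mapsTo hbY)⟩)
        fun h => ⟨h.1, h.2.2.2 _ ((hb Y).mapsTo hbY) _ ((hb X).mapsTo haX)⟩
  refine ⟨g, hg, fun s => ⟨fun a ha => ?_, fun a ha b hb' hab => ?_, fun c hc => ?_⟩, hmono⟩
  · obtain ⟨X, rfl, rfl, haX⟩ := HalfEdge.exists_interval_mem ha
    rw [hg X rfl a haX]
    have h1 := (f.η X).interval_subset_trace ((hb X).mapsTo haX)
    rwa [(f.η_mem_d X).1, (f.η_mem_d X).2] at h1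
  · by_contra hne
    rcases lt_or_gt_of_ne hne with h | h
    · exact (hmono s a ha b hb' h).ne hab
    · exact (hmono s b hb' a ha h).ne hab.symm
  · obtain ⟨Y, h1, h2, hcY⟩ := HalfEdge.exists_interval_mem hc
    have h3 : Y ∈ f.η '' A.graph.d l s := by
      rw [f.image_d]; exact ⟨h1, h2⟩
    obtain ⟨X, ⟨rfl, rfl⟩, rfl⟩ := h3
    obtain ⟨a, ha, rfl⟩ := (hb X).surjOn hcY
    exact ⟨a, X.interval_subset_trace ha, hg X rfl a ha⟩

/-- Compatible bijections between corresponding boundary intervals extend to a foliated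
homeomorphism of the disjoint unions of strips in the prescribed directions. -/
theorem exists_stripSum_homeomorph {m : HalfEdge A.S → ℝ → ℝ}
    (hb : ∀ X, BijOn (m X) X.interval (f.η X).interval)
    (hs : ∀ X : HalfEdge A.S, ∀ a ∈ X.interval, ∀ b ∈ X.interval, a < b →
      Signed (f.ε X.vertex) (· < ·) (m X a) (m X b)) :
    ∃ h : StripSum A.S ≃ₜ StripSum A'.S,
      (∀ p, (h p).1 = f.ν p.1) ∧
      (∀ X : HalfEdge A.S, ∀ p ∈ X.toSet, h p = (f.η X).pt (m X p.x)) ∧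
      (∀ p, (h p).IsInterior ↔ p.IsInterior) ∧
      (∀ p p', p.1 = p'.1 → ((h p).y = (h p').y ↔ p.y = p'.y)) ∧
      (∀ p p', p.1 = p'.1 → p.y = p'.y → p.x < p'.x →
        Signed (f.ε p.1) (· < ·) (h p).x (h p').x) ∧
      ∀ p p', p.1 = p'.1 → p.y < p'.y → Signed (f.τ p.1) (· < ·) (h p).y (h p').y := by
  choose g hg hgb hgs using exists_side_maps hb hs
  choose h hl hi hy hx ht using fun l =>
    (A.S l).exists_homeomorph (A'.S (f.ν l)) (f.ε l) (f.τ l) (hgb l) (hgs l)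
  let e : StripSum A.S ≃ StripSum A'.S :=
    Equiv.sigmaCongr f.ν fun l => (h l).toEquiv
  let H : StripSum A.S ≃ₜ StripSum A'.S := e.toHomeomorphOfContinuousOpen
    (continuous_sigma fun l =>
      (continuous_sigmaMk (σ := fun l => (A'.S l).carrier)).comp (h l).continuous)
    (isOpenMap_sigma.2 fun l =>
      (isOpenMap_sigmaMk (σ := fun l => (A'.S l).carrier)).comp (h l).isOpenMap)
  refine ⟨H, fun p => rfl, fun X p hp => ?_, fun p => hi p.1 p.2, ?_, ?_, ?_⟩
  · obtain ⟨l, p⟩ := p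
    obtain ⟨rfl, h2, h3⟩ := hp
    have h4 := hl X.vertex X.side p h3
    rw [hg X.vertex X rfl p.1.1 h2] at h4
    have hm : m X p.1.1 ∈ (f.η X).interval := (hb X).mapsTo h2
    have hpt := HalfEdge.pt_mem hm
    refine StripSum.ext_coord ((f.η_mem_d X).1.symm.trans hpt.1.symm)
      ((congrArg Prod.fst h4).trans (HalfEdge.pt_x hm).symm) ?_
    refine (congrArg Prod.snd h4).trans (Eq.trans ?_ hpt.2.2.symm)
    rw [(f.η_mem_d X).1, (f.η_mem_d X).2]
  · rintro ⟨l, p⟩ ⟨l', p'⟩ hll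
    obtain rfl : l = l' := hll
    exact hy l p p'
  · rintro ⟨l, p⟩ ⟨l', p'⟩ hll
    obtain rfl : l = l' := hll
    exact hx l p p'
  · rintro ⟨l, p⟩ ⟨l', p'⟩ hll
    obtain rfl : l = l' := hll
    exact ht l p p'

/-- Homeomorphisms upstairs that respect the fibres descend to quotient spaces. -/
theorem _root_.Topology.IsQuotientMap.exists_homeomorph {X Y X' Y' : Type*} [TopologicalSpace X]
    [TopologicalSpace Y] [TopologicalSpace X'] [TopologicalSpace Y'] {q : X → Y} {q' : X' → Y'}
    (hq : IsQuotientMap q) (hq' : IsQuotientMap q') (h : X ≃ₜ X')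
    (hfib : ∀ p p', q p = q p' ↔ q' (h p) = q' (h p')) :
    ∃ k : Y ≃ₜ Y', ∀ p, k (q p) = q' (h p) := by
  have hr : IsQuotientMap fun p => q' (h p) := hq'.comp h.isQuotientMap
  choose s hs using hq.surjective
  choose t ht using hr.surjective
  have hk : ∀ p, q' (h (s (q p))) = q' (h p) := fun p => (hfib _ _).1 (hs _)
  have hk' : ∀ p, q (t (q' (h p))) = q p := fun p => (hfib _ _).2 (ht _)
  refine ⟨⟨⟨fun y => q' (h (s y)), fun y => q (t y), fun y => ?_, fun y => ?_⟩, ?_, ?_⟩, hk⟩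
  · simp only
    rw [hk', hs]
  · simp only
    rw [hk]
    exact ht y
  · exact hq.continuous_iff.2 (hr.continuous.congr fun p => (hk p).symm)
  · exact hr.continuous_iff.2 (hq.continuous.congr fun p => (hk' p).symm)

variable (f)

/-- Every isomorphism of graphs is induced by an equivalence. -/
theorem exists_equivalence [ChartedSpace (EuclideanHalfSpace 2) Z]
    [ChartedSpace (EuclideanHalfSpace 2) Z'] : ∃ E : A.Equivalence A', E.Induces f := by
  obtain ⟨m, hb, hs, hm⟩ := f.exists_boundary_maps
  obtain ⟨h, hv, hX, hi, hy, hx, ht⟩ := exists_stripSum_homeomorph hb hs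
  have hXm : ∀ {X : HalfEdge A.S} {p}, p ∈ X.toSet → h p ∈ (f.η X).toSet := fun {X p} hp => by
    rw [hX X p hp]; exact HalfEdge.pt_mem ((hb X).mapsTo hp.2.1)
  have hXi : ∀ X : HalfEdge A.S, h '' X.toSet = (f.η X).toSet := fun X => by
    refine Subset.antisymm (by rintro _ ⟨p, hp, rfl⟩; exact hXm hp) fun w hw => ?_
    obtain ⟨a, ha, hw'⟩ := (hb X).surjOn hw.2.1
    refine ⟨X.pt a, HalfEdge.pt_mem ha, ?_⟩
    rw [hX X _ (HalfEdge.pt_mem ha), HalfEdge.pt_x ha, hw', HalfEdge.pt_of_mem hw]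
  have hF : IsFoliated (stripLeaves A.S) (stripLeaves A'.S) h := by
    rintro ω (⟨l, t, htl, rfl⟩ | ⟨X, rfl⟩)
    · have hc := (A.S l).mem_carrier_of_mem_Ioo (z := (0, t)) htl
      have h1 : (StripSum.mk A.S l (0, t)).1 = l := StripSum.mk_fst _ _
      have h2 : (StripSum.mk A.S l (0, t)).y = t := StripSum.mk_y hc
      refine Or.inl ⟨f.ν l, (h (StripSum.mk A.S l (0, t))).y,
        ((hi _).2 (StripSum.isInterior_mk htl)).mem ((hv _).trans (congrArg f.ν h1)), ?_⟩
      ext w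
      obtain ⟨p, rfl⟩ := h.surjective w
      rw [h.injective.mem_set_image]
      constructor
      · rintro ⟨rfl, rfl⟩
        exact ⟨hv p, (hy p _ h1.symm).2 h2.symm⟩
      · rintro ⟨h3, h4⟩
        have h5 : p.1 = l := f.ν.injective ((hv p).symm.trans h3)
        exact ⟨h5, ((hy p _ (h5.trans h1.symm)).1 h4).trans h2⟩
    · exact Or.inr ⟨f.η X, hXi X⟩
  have hglue : ∀ {X : HalfEdge A.S} {p r}, A.ξ X ≠ X → p ∈ X.toSet → r ∈ (A.ξ X).toSet →
      A.q p = A.q r → A'.q (h p) = A'.q (h r) := fun {X p r} hne hp hr hq => by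
    rw [hX X p hp, hX _ r hr]
    refine hm X hne _ hp.2.1 _ hr.2.1 ?_
    rw [HalfEdge.pt_of_mem hp, HalfEdge.pt_of_mem hr, hq]
  have hfib : ∀ p p', A.q p = A.q p' ↔ A'.q (h p) = A'.q (h p') := by
    intro p p'
    constructor
    · intro hq
      rcases eq_or_exists_glued hq with rfl | ⟨X, hne, hp, hp'⟩
      · rfl
      · exact hglue hne hp hp' hq
    · intro hq
      rcases eq_or_exists_glued hq with h' | ⟨X', hne', hp, hp'⟩
      · rw [h.injective h']
      · obtain ⟨X, rfl⟩ := f.η.surjective X'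
        have hne : A.ξ X ≠ X := fun h => hne' (by rw [f.ξ_η, h])
        rw [f.ξ_η, ← hXi, h.injective.mem_set_image] at hp'
        rw [← hXi, h.injective.mem_set_image] at hp
        -- The point glued to `p` has the same image in `Z'` as `p'`, so it is `p'`.
        obtain ⟨r, hr, hpr⟩ := exists_glued_point hne hp
        have h1 : A'.q (h r) = A'.q (h p') := (hglue hne hp hr hpr).symm.trans hq
        have h2 : h r = h p' := injOn_glued (f.ξ_η_ne (A.ξ_ne hne)) (hXm hr) (hXm hp') h1
        rw [hpr, h.injective h2]
  obtain ⟨k, hk⟩ := A.isQuotientMap.exists_homeomorph A'.isQuotientMap h hfib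
  refine ⟨⟨h, k, hF, ?_, hk⟩, ⟨fun l => ?_, hXi, fun p p' h1 _ _ h2 h3 => hx p p' h1 h2 h3,
    fun p p' h1 _ _ h2 => ht p p' h1 h2⟩⟩
  · rintro _ ⟨ω, hω, rfl⟩
    refine ⟨h '' ω, hF ω hω, ?_⟩
    simp only [image_image, hk]
  · ext w
    obtain ⟨p, rfl⟩ := h.surjective w
    rw [h.injective.mem_set_image]
    constructor
    · rintro rfl
      exact hv p
    · exact fun h1 => f.ν.injective ((hv p).symm.trans h1)

end StripedGraph.Iso
theorem mainTheorem2 {Λ Γ Z Λ' Γ' Z' : Type*}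
    [TopologicalSpace Z] [T2Space Z] [SecondCountableTopology Z]
    [ChartedSpace (EuclideanHalfSpace 2) Z]
    [TopologicalSpace Z'] [T2Space Z'] [SecondCountableTopology Z']
    [ChartedSpace (EuclideanHalfSpace 2) Z']
    (A : StripedAtlas Λ Γ Z) (A' : StripedAtlas Λ' Γ' Z') :
    (∀ E : A.Equivalence A', ∃! f : A.graph.Iso A'.graph, E.Induces f) ∧
      (∀ f : A.graph.Iso A'.graph, ∃ E : A.Equivalence A', E.Induces f) := by
  refine ⟨fun E => ?_, fun f => f.exists_equivalence⟩
  obtain ⟨f, hf⟩ := E.exists_induces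
  exact ⟨f, hf, fun g hg => hg.unique hf⟩
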